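/- **Setting.** Let $X$ be a compact complex manifold of dimension $n$, let $L:=K_X^*=\det(T^{(1,0)}X)$, and let $p\geq 1$ be an integer such that for every $x\in X$ the evaluation map $H^0(X,L^p)\to L^p_x$ is surjective, i.e. the Kodaira map of $L^p$ is well defined. Write $n_p=\dim H^0(X,L^p)$. A Hermitian metric $h$ on $L$ induces the metric $h^p$ on $L^p$ and the anticanonical volume form $d\nu_h=\sqrt{-1}^{\,n^2}\,\theta\wedge\bar\theta/|\theta|^2_{h^{-1}}$, where $\theta$ is any non-vanishing local section of $K_X$. Write $$\langle s_1,s_2\rangle_{L^2(h^p)}=\int_X\langle s_1,s_2\rangle_{h^p}\,d\nu_h,\qquad \mathrm{Hilb}_\nu(h^p)=\frac{n_p}{\mathrm{Vol}(d\nu_h)}\,L^2(h^p).$$ For a Hermitian product $H$ on $H^0(X,L^p)$, let $\Pi_H(x)$ be the $H$-orthogonal projector with kernel $\{s : s(x)=0\}$, and let $\mathrm{FS}(H)$ be the metric on $L^p$ with $\langle s_1(x),s_2(x)\rangle_{\mathrm{FS}(H)}=\langle\Pi_H(x)s_1,s_2\rangle_H$. For a basis $\mathbf s=\{s_j\}$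 of $H^0(X,L^p)$, let $H_{\mathbf s}$ be the Hermitian product for which $\mathbf s$ is orthonormal, let $h_{\mathbf s}$ be the metric on $L$ with $h_{\mathbf s}^p=\mathrm{FS}(H_{\mathbf s})$, write $d\nu_{\mathbf s}:=d\nu_{h_{\mathbf s}}$, and set $$\mu_\nu(\mathbf s)=\Big(\int_X\langle s_j,s_k\rangle_{h_{\mathbf s}^p}\,d\nu_{\mathbf s}\Big)_{j,k}-\frac{\mathrm{Vol}(d\nu_{\mathbf s})}{n_p}\,\mathrm{Id}.$$ For a Hermitian matrix $A$, write $D_{\mathbf s}\mu_\nu(A)=\frac{d}{dt}\big|_{t=0}\,\mu_\nu(e^{tA}\mathbf s)$, where $(G\mathbf s)_j=\sum_k G_{jk}s_k$. Finally, let $\rho_{h^p}$ be the function with $\rho_{h^p}(x)\,\langle\Pi_{L^2(h^p)}(x)s_1,s_2\rangle_{L^2(h^p)}=\langle s_1(x),s_2(x)\rangle_{h^p}$ for all $s_1,s_2$, and let $\mathcal E_{h^p}$ be the Berezin–Toeplitz quantum channel $$\mathcal E_{h^p}(T)=\int_X \mathrm{Tr}\big[T\,\Pi_{L^2(h^p)}(x)\big]\,\Pi_{L^2(h^p)}(x)\,\rho_{h^p}(x)\,d\nu_h(x).$$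 **Proposition 3.7.** Let $h$ be a positive Hermitian metric on $L=K_X^*$ (so that $X$ is Fano) such that $h^p$ is anticanonically balanced, i.e. $\mathrm{FS}(\mathrm{Hilb}_\nu(h^p))=h^p$, and let $\mathbf s_p$ be a basis of $H^0(X,L^p)$ that is orthonormal for $L^2(h^p)$. Then for every Hermitian matrix $A$ of size $n_p$ with $\mathrm{Tr}[A]=0$, the derivative $D_{\mathbf s_p}\mu_\nu(A)$ exists and $$\frac{n_p}{2\,\mathrm{Vol}(d\nu_{\mathbf s_p})}\,\mathrm{Tr}\big[A\,D_{\mathbf s_p}\mu_\nu(A)\big]=\mathrm{Tr}[A^2]-\Big(1+\frac1p\Big)\mathrm{Tr}\big[A\,\mathcal E_{h^p}(A)\big],$$ where in the last term $A$ is identified with the endomorphism $s_j\mapsto\sum_k A_{jk}s_k$ of $H^0(X,L^p)$, for $\mathbf s_p=\{s_j\}$. -/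

import Mathlib

open Bundle MeasureTheory Module Set
open scoped Manifold ContDiff ComplexConjugate

namespace AnticanBalanced

noncomputable section

/-! ### Line bundles -/

section LineBundles

variable {B ι : Type*} [TopologicalSpace B] {n : ℕ}

/-- The determinant line bundle `det T` of a complex vector bundle `T` of rank `n`, given by
cocycles: its transition functions are the determinants of those of `T`. -/
def detBundle (T : VectorBundleCore ℂ B (Fin n → ℂ) ι) : VectorBundleCore ℂ B ℂ ι where
  baseSet := T.baseSet
  isOpen_baseSet := T.isOpen_baseSet
  indexAt := T.indexAt
  mem_baseSet_at := T.mem_baseSet_at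
  coordChange i j x := (T.coordChange i j x).det • ContinuousLinearMap.id ℂ ℂ
  coordChange_self i x hx v := by
    have : T.coordChange i i x = ContinuousLinearMap.id ℂ _ := by
      ext1 v
      exact T.coordChange_self i x hx v
    simp [this, ContinuousLinearMap.det]
  continuousOn_coordChange i j :=
    (ContinuousLinearMap.continuous_det.comp_continuousOn
      (T.continuousOn_coordChange i j)).smul continuousOn_const
  coordChange_comp i j k x hx v := by
    have : T.coordChange i k x = (T.coordChange j k x).comp (T.coordChange i j x) := by
      ext1 v
      exact (T.coordChange_comp i j k x hx v).symm
    simp [this, ContinuousLinearMap.det, mul_assoc]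

/-- The `p`-th tensor power `L^p` of a line bundle `L`, given by cocycles: its transition
functions are the `p`-th powers of those of `L`. -/
def tensorPower (L : VectorBundleCore ℂ B ℂ ι) (p : ℕ) : VectorBundleCore ℂ B ℂ ι where
  baseSet := L.baseSet
  isOpen_baseSet := L.isOpen_baseSet
  indexAt := L.indexAt
  mem_baseSet_at := L.mem_baseSet_at
  coordChange i j x := (L.coordChange i j x 1) ^ p • ContinuousLinearMap.id ℂ ℂ
  coordChange_self i x hx v := by simp [L.coordChange_self i x hx]
  continuousOn_coordChange i j :=
    (((L.continuousOn_coordChange i j).clm_apply continuousOn_const).pow p).smul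
      continuousOn_const
  coordChange_comp i j k x hx v := by
    have h := L.coordChange_comp i j k x hx 1
    have h2 : ∀ a : ℂ, L.coordChange j k x a = a * L.coordChange j k x 1 := fun a => by
      rw [← smul_eq_mul, ← map_smul, smul_eq_mul, mul_one]
    rw [h2] at h
    simp only [_root_.smul_apply, ContinuousLinearMap.id_apply, smul_eq_mul, ← h,
      mul_pow]
    ring

end LineBundles

/-! ### Partitions of unity subordinate to the charts -/

theorem exists_partition (n : ℕ) (X : Type*) [TopologicalSpace X] [ChartedSpace (Fin n → ℂ) X]
    [T2Space X] [CompactSpace X] : ∃ ρ : PartitionOfUnity (atlas (Fin n → ℂ) X) X,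
      ρ.IsSubordinate fun i => i.1.source :=
  PartitionOfUnity.exists_isSubordinate isClosed_univ _ (fun i => i.1.open_source)
    fun x _ => mem_iUnion.2 ⟨achart _ x, mem_chart_source _ x⟩

/-- A partition of unity subordinate to the covering of `X` by the charts of its atlas. -/
def chartPartition (n : ℕ) (X : Type*) [TopologicalSpace X] [ChartedSpace (Fin n → ℂ) X]
    [T2Space X] [CompactSpace X] : PartitionOfUnity (atlas (Fin n → ℂ) X) X :=
  (exists_partition n X).choose

theorem chartPartition_subordinate (n : ℕ) (X : Type*) [TopologicalSpace X]
    [ChartedSpace (Fin n → ℂ) X] [T2Space X] [CompactSpace X] :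
    (chartPartition n X).IsSubordinate fun i => i.1.source :=
  (exists_partition n X).choose_spec

theorem measurableSet_chart {n : ℕ} {X : Type*} [TopologicalSpace X] [MeasurableSpace X]
    [BorelSpace X] [ChartedSpace (Fin n → ℂ) X] (i : atlas (Fin n → ℂ) X) (C : Set X) (hC : MeasurableSet C) :
    MeasurableSet (i.1.target ∩ i.1.symm ⁻¹' C) := by
  have h1 : Measurable (i.1.target.domRestrict i.1.symm) :=
    (continuousOn_iff_continuous_domRestrict.1 i.1.continuousOn_symm).measurable
  have h2 := i.1.open_target.measurableSet.subtype_image (h1 hC)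
  convert h2 using 1
  ext z
  simp [and_comm]

variable (n : ℕ) (X : Type*) [TopologicalSpace X] [ChartedSpace (Fin n → ℂ) X]
  [IsManifold 𝓘(ℂ, Fin n → ℂ) ω X]

/-- The anticanonical line bundle `K_X^* = det (T^{(1,0)} X)` of a complex manifold `X` of
dimension `n`. It is trivialised over each chart of the atlas, by the frame `∂₁ ∧ ⋯ ∧ ∂ₙ`.

Its fibre over `x`, a copy of `ℂ`, is spanned by the frame vector `1`, which
is `∂₁ ∧ ⋯ ∧ ∂ₙ` at `x` for the coordinates of the preferred chart `achart _ x` at `x`. In the same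
way, the fibre of `L^p` over `x` is spanned by the frame vector `1 = (∂₁ ∧ ⋯ ∧ ∂ₙ)^p`. -/
abbrev anticanonicalBundle : VectorBundleCore ℂ X ℂ (atlas (Fin n → ℂ) X) :=
  detBundle (tangentBundleCore 𝓘(ℂ, Fin n → ℂ) X)

/-- The space `H⁰(X, L^p)` of holomorphic sections of `L^p`, where `L = K_X^*`. -/
abbrev HolSections (p : ℕ) : Type _ :=
  Cₛ^ω⟮𝓘(ℂ, Fin n → ℂ); ℂ, (tensorPower (anticanonicalBundle n X) p).Fiber⟯

/-- The dimension `n_p` of `H⁰(X, L^p)`. -/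
def dimSections (p : ℕ) : ℕ := finrank ℂ (HolSections n X p)

variable {X}

/-- The evaluation map `ev_x : s ↦ s(x)` from `H⁰(X, L^p)` to the fibre of `L^p` over `x`,
in the frame vector of this fibre. -/
def evalAt (p : ℕ) (x : X) : HolSections n X p →ₗ[ℂ] ℂ where
  toFun s := s x
  map_add' _ _ := rfl
  map_smul' _ _ := rfl

variable (X) in
/-- The Kodaira map `x ↦ {s ∈ H⁰(X, L^p) | s(x) = 0}` is well defined: all the evaluation maps
are surjective. -/
def KodairaMapWellDefined (p : ℕ) : Prop :=
  ∀ x : X, Function.Surjective (evalAt n p x)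

/-! ### Hermitian metrics

A Hermitian metric on a line bundle is given by the function `w : X → ℝ` sending `x` to the squared
length of the frame vector of the fibre over `x`. So `⟨a, b⟩ = w x * a * conj b` in this fibre.
If `w` stands for the metric `h` on `L`, then `w ^ p` stands for the induced metric `h^p`
on `L^p`. -/

/-- The squared length `|∂₁ ∧ ⋯ ∧ ∂ₙ|²_h` at `x` of the frame of `K_X^*` in the chart `i`, for the
metric `h` on `K_X^*` given by `w`. -/
def frameNormSq (w : X → ℝ) (i : atlas (Fin n → ℂ) X) (x : X) : ℝ :=
  w x * ‖(anticanonicalBundle n X).coordChange i ((anticanonicalBundle n X).indexAt x) x 1‖ ^ 2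

variable (X) in
/-- A (smooth) Hermitian metric `h` on `K_X^*`. -/
structure HermitianMetric where
  /-- the squared length of the frame vector of each fibre -/
  normSq : X → ℝ
  pos : ∀ x, 0 < normSq x
  smooth : ∀ i : atlas (Fin n → ℂ) X,
    ContDiffOn ℝ ∞ (fun z => frameNormSq n normSq i (i.1.symm z)) i.1.target

variable {n}

/-- The form `ω_h = (√-1 / 2π) R_h`, where `R_h = - ∂∂̄ log |∂₁ ∧ ⋯ ∧ ∂ₙ|²_h` is the Chern
curvature of `h`, in the coordinates `z` of the chart `i`. It is evaluated on two
real tangent vectors `v`, `v'`, with the complex structure `J` being the multiplication by `√-1`.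
For a real function `u` we have
`(√-1 ∂∂̄ u)(v, v') = (D²u(J v, v') - D²u(v, J v')) / 2`. -/
def HermitianMetric.chernForm (h : HermitianMetric n X) (i : atlas (Fin n → ℂ) X)
    (z v v' : Fin n → ℂ) : ℝ :=
  let u : (Fin n → ℂ) → ℝ := fun z => - Real.log (frameNormSq n h.normSq i (i.1.symm z))
  1 / (2 * Real.pi) *
    ((fderiv ℝ (fderiv ℝ u) z (Complex.I • v) v' - fderiv ℝ (fderiv ℝ u) z v (Complex.I • v')) / 2)

/-- `h` is a positive Hermitian metric: the form `g = ω_h(·, J ·)` is positive definite, i.e. it is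
a Riemannian metric. -/
def HermitianMetric.IsPositive (h : HermitianMetric n X) : Prop :=
  ∀ (i : atlas (Fin n → ℂ) X), ∀ z ∈ i.1.target, ∀ v : Fin n → ℂ, v ≠ 0 →
    0 < h.chernForm i z v (Complex.I • v)

/-! ### The anticanonical volume form -/

section Volume

theorem frameNormSq_change (w : X → ℝ) (i j : atlas (Fin n → ℂ) X) (x : X)
    (hi : x ∈ i.1.source) (hj : x ∈ j.1.source) :
    frameNormSq n w i x = frameNormSq n w j x *
      ‖((tangentBundleCore 𝓘(ℂ, Fin n → ℂ) X).coordChange i j x).det‖ ^ 2 := by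
  have h := (anticanonicalBundle n X).coordChange_comp i j ((anticanonicalBundle n X).indexAt x) x
    ⟨⟨hi, hj⟩, (anticanonicalBundle n X).mem_baseSet_at x⟩ 1
  unfold frameNormSq
  rw [← h]
  simp [detBundle]
  ring

theorem det_restrict (n : ℕ) (f : (Fin n → ℂ) →L[ℂ] (Fin n → ℂ)) :
    |(f.restrictScalars ℝ).det| = ‖f.det‖ ^ 2 := by
  have := LinearMap.det_restrictScalars (R := ℝ) (S := ℂ) (f := (f : (Fin n → ℂ) →ₗ[ℂ] _))
  have h2 : (f.restrictScalars ℝ).det = LinearMap.det ((f : (Fin n → ℂ) →ₗ[ℂ] _).restrictScalars ℝ) := rfl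
  rw [h2, this, Algebra.norm_complex_apply, Complex.normSq_eq_norm_sq]
  simp [ContinuousLinearMap.det]

variable [MeasurableSpace X] [BorelSpace X]

variable (n) in
/-- The Lebesgue measure of the chart `i`, as a measure on `X` supported by this chart. -/
def chartLebesgue (i : atlas (Fin n → ℂ) X) : Measure X :=
  ((volume : Measure (Fin n → ℂ)).restrict i.1.target).map i.1.symm

theorem setLIntegral_coordChange (i j : atlas (Fin n → ℂ) X) (C : Set X) (hC : MeasurableSet C)
    (hCi : C ⊆ i.1.source) (hCj : C ⊆ j.1.source) (G : X → ENNReal) :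
    ∫⁻ z in j.1.target ∩ j.1.symm ⁻¹' C, G (j.1.symm z) =
      ∫⁻ z in i.1.target ∩ i.1.symm ⁻¹' C, ENNReal.ofReal
        (‖((tangentBundleCore 𝓘(ℂ, Fin n → ℂ) X).coordChange i j (i.1.symm z)).det‖ ^ 2) *
          G (i.1.symm z) := by
  set S := i.1.target ∩ i.1.symm ⁻¹' C with hS
  have himg : j.1.target ∩ j.1.symm ⁻¹' C = (fun z => j.1 (i.1.symm z)) '' S := by
    ext z
    constructor
    · rintro ⟨hz, hzC⟩
      refine ⟨i.1 (j.1.symm z), ⟨i.1.map_source (hCi hzC), ?_⟩, ?_⟩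
      · simpa [i.1.left_inv (hCi hzC)] using hzC
      · simp [i.1.left_inv (hCi hzC), j.1.right_inv hz]
    · rintro ⟨y, ⟨hy, hyC⟩, rfl⟩
      refine ⟨j.1.map_source (hCj hyC), ?_⟩
      simpa [j.1.left_inv (hCj hyC)] using hyC
  have hd : ∀ z ∈ S, HasFDerivWithinAt (fun z => j.1 (i.1.symm z))
      (((tangentBundleCore 𝓘(ℂ, Fin n → ℂ) X).coordChange i j (i.1.symm z)).restrictScalars ℝ)
      S z := by
    rintro z ⟨hz, hzC⟩
    have h1 : ContDiffWithinAt ℂ 1 (j.1.extend 𝓘(ℂ, Fin n → ℂ) ∘ (i.1.extend 𝓘(ℂ, Fin n → ℂ)).symm)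
        (range 𝓘(ℂ, Fin n → ℂ)) z := by
      have hzs : z ∈ ((i.1.extend 𝓘(ℂ, Fin n → ℂ)).symm ≫ j.1.extend 𝓘(ℂ, Fin n → ℂ)).source := by
        simpa using ⟨hz, hCj hzC⟩
      exact (ModelWithCorners.contDiffOn_extendCoordChange
        (IsManifold.subset_maximalAtlas i.2)
        (IsManifold.subset_maximalAtlas j.2) z hzs).mono_of_mem_nhdsWithin
          (ModelWithCorners.extendCoordChange_source_mem_nhdsWithin hzs)
    have h2 := (h1.differentiableWithinAt one_ne_zero).hasFDerivWithinAt
    have h3 : i.1.extend 𝓘(ℂ, Fin n → ℂ) (i.1.symm z) = z := by simp [i.1.right_inv hz]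
    rw [tangentBundleCore_coordChange, h3]
    have h4 := h2.restrictScalars ℝ
    exact h4.mono (by simp)
  have hinj : InjOn (fun z => j.1 (i.1.symm z)) S := by
    rintro z ⟨hz, hzC⟩ y ⟨hy, hyC⟩ h
    exact i.1.symm.injOn hz hy (j.1.injOn (hCj hzC) (hCj hyC) h)
  rw [himg, lintegral_image_eq_lintegral_abs_det_fderiv_mul volume
    (measurableSet_chart i C hC) hd hinj]
  refine setLIntegral_congr_fun (measurableSet_chart i C hC) ?_
  rintro z ⟨hz, hzC⟩
  simp only
  rw [det_restrict, j.1.left_inv (hCj hzC)]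

set_option linter.unusedSectionVars false in
theorem setLIntegral_chartLebesgue (i : atlas (Fin n → ℂ) X) (C : Set X) (hC : MeasurableSet C)
    (G : X → ENNReal) (hG : AEMeasurable G ((chartLebesgue n i).restrict C)) :
    ∫⁻ x in C, G x ∂(chartLebesgue n i) = ∫⁻ z in i.1.target ∩ i.1.symm ⁻¹' C, G (i.1.symm z) := by
  have hm : AEMeasurable i.1.symm ((volume : Measure (Fin n → ℂ)).restrict i.1.target) :=
    i.1.continuousOn_symm.aemeasurable i.1.open_target.measurableSet
  have hr : (chartLebesgue n i).restrict C =
      ((volume : Measure (Fin n → ℂ)).restrict (i.1.target ∩ i.1.symm ⁻¹' C)).map i.1.symm := by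
    ext B hB
    have hm' : AEMeasurable i.1.symm ((volume : Measure (Fin n → ℂ)).restrict (i.1.target ∩ i.1.symm ⁻¹' C)) :=
      hm.mono_measure (Measure.restrict_mono inter_subset_left le_rfl)
    have hT : NullMeasurableSet (i.1.target ∩ i.1.symm ⁻¹' C) (volume : Measure (Fin n → ℂ)) :=
      (measurableSet_chart i C hC).nullMeasurableSet
    rw [Measure.restrict_apply hB, chartLebesgue, Measure.map_apply_of_aemeasurable hm (hB.inter hC),
      Measure.map_apply_of_aemeasurable hm' hB, Measure.restrict_apply₀' i.1.open_target.measurableSet.nullMeasurableSet,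
      Measure.restrict_apply₀' hT]
    congr 1
    ext z
    simp; tauto
  rw [hr] at hG ⊢
  rw [lintegral_map' hG]
  exact hm.mono_measure (Measure.restrict_mono inter_subset_left le_rfl)

variable [T2Space X] [CompactSpace X]

variable (n) in
/-- The measure defined by the anticanonical volume form
`dν_h = √-1 ^ (n²) θ ∧ θ̄ / |θ|²_{h⁻¹}` of the metric `h` on `K_X^*` given by `w`.

In the chart `i`, take `θ = dz₁ ∧ ⋯ ∧ dzₙ`. Then `√-1 ^ (n²) θ ∧ θ̄` is `2 ^ n` times the Lebesgue
measure, and `|θ|²_{h⁻¹}` is the inverse of `|∂₁ ∧ ⋯ ∧ ∂ₙ|²_h`. The local measures thus obtained are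
glued by a partition of unity `ρ`; see `anticanVolume_apply` for the value on
an arbitrary chart. -/
def anticanVolume (w : X → ℝ) : Measure X :=
  Measure.sum fun i : atlas (Fin n → ℂ) X =>
    (chartLebesgue n i).withDensity fun x =>
      ENNReal.ofReal (chartPartition n X i x * (2 ^ n * frameNormSq n w i x))

variable (n) in
/-- The total volume `Vol(dν_h)`. -/
def totalVolume (w : X → ℝ) : ℝ := (anticanVolume n w).real univ

/-- The value of the measure `dν_h` on a Borel set contained in an arbitrary chart `i`. In
particular, it does not depend on the partition of unity. -/
theorem anticanVolume_apply (w : X → ℝ) (hw : ∀ x, 0 ≤ w x)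
    (hc : ∀ i : atlas (Fin n → ℂ) X, ContinuousOn (frameNormSq n w i) i.1.source)
    (i : atlas (Fin n → ℂ) X) (C : Set X) (hC : MeasurableSet C) (hCi : C ⊆ i.1.source) :
    anticanVolume n w C = ∫⁻ z in i.1.target ∩ i.1.symm ⁻¹' C,
      ENNReal.ofReal (2 ^ n * frameNormSq n w i (i.1.symm z)) := by
  set ρ := chartPartition n X with hρ
  have hd0 : ∀ j x, 0 ≤ frameNormSq n w j x := fun j x => mul_nonneg (hw x) (by positivity)
  have hρ0 : ∀ j x, x ∉ j.1.source → ρ j x = 0 := fun j x hx => by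
    by_contra h
    exact hx (chartPartition_subordinate n X j (subset_closure h))
  set T := i.1.target ∩ i.1.symm ⁻¹' C with hT
  have hTm : MeasurableSet T := measurableSet_chart i C hC
  have hterm : ∀ j : atlas (Fin n → ℂ) X,
      (chartLebesgue n j).withDensity (fun x =>
        ENNReal.ofReal (ρ j x * (2 ^ n * frameNormSq n w j x))) C =
      ∫⁻ z in T, ENNReal.ofReal (ρ j (i.1.symm z)) *
        ENNReal.ofReal (2 ^ n * frameNormSq n w i (i.1.symm z)) := by
    intro j
    have hmeas : AEMeasurable (fun x => ENNReal.ofReal (ρ j x * (2 ^ n * frameNormSq n w j x)))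
        ((chartLebesgue n j).restrict (C ∩ j.1.source)) := by
      refine (ContinuousOn.aemeasurable ?_ (hC.inter j.1.open_source.measurableSet)).ennreal_ofReal
      exact (ρ j).continuous.continuousOn.mul
        (continuousOn_const.mul ((hc j).mono inter_subset_right))
    have hjm : MeasurableSet j.1.source := j.1.open_source.measurableSet
    have hDm : MeasurableSet (C ∩ j.1.source) := hC.inter hjm
    rw [withDensity_apply _ hC, ← lintegral_inter_add_sdiff _ C hjm,
      setLIntegral_congr_fun (g := fun _ => 0) (hC.diff hjm)
        (fun x hx => by simp [hρ0 j x hx.2]), lintegral_zero, add_zero,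
      setLIntegral_chartLebesgue j _ hDm _ hmeas, setLIntegral_coordChange i j _ hDm
        (inter_subset_left.trans hCi) inter_subset_right
        (fun x => ENNReal.ofReal (ρ j x * (2 ^ n * frameNormSq n w j x)))]
    rw [← lintegral_inter_add_sdiff _ T (measurableSet_chart i j.1.source hjm),
      setLIntegral_congr_fun (s := T \ _) (g := fun _ => 0)
        (hTm.diff (measurableSet_chart i j.1.source hjm))
      (fun z hz => by
        have : i.1.symm z ∉ j.1.source := fun h => hz.2 ⟨hz.1.1, h⟩
        simp [hρ0 j _ this]), lintegral_zero, add_zero]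
    have hset : T ∩ (i.1.target ∩ i.1.symm ⁻¹' j.1.source) =
        i.1.target ∩ i.1.symm ⁻¹' (C ∩ j.1.source) := by
      ext z; simp [hT]; tauto
    rw [hset]
    refine setLIntegral_congr_fun (measurableSet_chart i _ hDm) ?_
    rintro z ⟨hz, hzC, hzj⟩
    have h0 := ρ.nonneg j (i.1.symm z)
    have h1 := hd0 j (i.1.symm z)
    simp only
    rw [← ENNReal.ofReal_mul (by positivity), ← ENNReal.ofReal_mul h0,
      frameNormSq_change w i j _ (i.1.map_target hz) hzj]
    congr 1
    ring
  have hfin : {j | (Function.support (ρ j)).Nonempty}.Finite :=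
    ρ.locallyFinite.finite_nonempty_of_compact
  change (Measure.sum fun j : atlas (Fin n → ℂ) X => (chartLebesgue n j).withDensity fun x =>
    ENNReal.ofReal (ρ j x * (2 ^ n * frameNormSq n w j x))) C = _
  rw [Measure.sum_apply _ hC, tsum_congr hterm]
  rw [tsum_eq_sum (s := hfin.toFinset), ← lintegral_finsetSum']
  · refine setLIntegral_congr_fun hTm ?_
    intro z hz
    show ∑ j ∈ hfin.toFinset, ENNReal.ofReal (ρ j (i.1.symm z)) * _ = _
    rw [← Finset.sum_mul, ← ENNReal.ofReal_sum_of_nonneg fun j _ => ρ.nonneg j _]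
    have : ∑ j ∈ hfin.toFinset, ρ j (i.1.symm z) = 1 := by
      rw [← ρ.sum_eq_one (mem_univ (i.1.symm z))]
      symm
      apply finsum_eq_sum_of_support_subset
      intro j hj
      exact Finset.mem_coe.2 (hfin.mem_toFinset.2 ⟨_, hj⟩)
    rw [this]; simp
  · intro j _
    have hsc : ContinuousOn i.1.symm T := i.1.continuousOn_symm.mono inter_subset_left
    have h1 : ContinuousOn (fun z => frameNormSq n w i (i.1.symm z)) T :=
      (hc i).comp hsc fun z hz => i.1.map_target hz.1
    exact ((((ρ j).continuous.comp_continuousOn hsc).aemeasurable hTm).ennreal_ofReal).mul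
      ((continuousOn_const.mul h1).aemeasurable hTm).ennreal_ofReal
  · intro j hj
    have : ∀ x, ρ j x = 0 := fun x => by
      by_contra h
      exact hj (hfin.mem_toFinset.2 ⟨x, h⟩)
    simp [this]

end Volume

/-! ### Hermitian products, Fubini-Study and Hilbert maps

A Hermitian product `H` on `V = H⁰(X, L^p)` is given by the function `H : V → V → ℂ` of its values,
linear in the first variable. -/

section Products

variable {p : ℕ}

/-- `P` is the orthogonal projector with respect to `H` whose kernel is `{s | s(x) = 0}`. -/
def IsCoherentProjector (H : HolSections n X p → HolSections n X p → ℂ) (x : X)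
    (P : HolSections n X p →ₗ[ℂ] HolSections n X p) : Prop :=
  P ∘ₗ P = P ∧ (∀ u v, H (P u) v = H u (P v)) ∧ LinearMap.ker P = LinearMap.ker (evalAt n p x)

/-- The coherent state projector `Π_H(x)`. -/
def coherentProjector (H : HolSections n X p → HolSections n X p → ℂ) (x : X) :
    HolSections n X p →ₗ[ℂ] HolSections n X p :=
  Classical.epsilon (IsCoherentProjector H x)

/-- The Fubini-Study metric `FS(H)` on `L^p`, defined by
`⟨s₁(x), s₂(x)⟩_{FS(H)} = ⟨Π_H(x) s₁, s₂⟩_H` for all sections `s₁`, `s₂`. -/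
def fubiniStudy (H : HolSections n X p → HolSections n X p → ℂ) (x : X) : ℝ :=
  Classical.epsilon fun c : ℝ => ∀ s₁ s₂ : HolSections n X p,
    c * evalAt n p x s₁ * conj (evalAt n p x s₂) = H (coherentProjector H x s₁) s₂

/-- The Berezin symbol `σ_H(T) = Tr[T Π_H]`. -/
def berezinSymbol (H : HolSections n X p → HolSections n X p → ℂ)
    (T : HolSections n X p →ₗ[ℂ] HolSections n X p) (x : X) : ℂ :=
  LinearMap.trace ℂ _ (T ∘ₗ coherentProjector H x)

/-- The Hermitian product `H_s` for which the basis `s` is orthonormal. -/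
def basisProduct (s : Basis (Fin (dimSections n X p)) ℂ (HolSections n X p))
    (u v : HolSections n X p) : ℂ :=
  ∑ j, s.repr u j * conj (s.repr v j)

theorem evalAt_eq_sum (s : Basis (Fin (dimSections n X p)) ℂ (HolSections n X p)) (x : X) (u) :
    evalAt n p x u = ∑ j, s.repr u j * evalAt n p x (s j) := by
  conv_lhs => rw [← s.sum_repr u]
  simp only [map_sum, map_smul, smul_eq_mul]

theorem basisProduct_conj (s : Basis (Fin (dimSections n X p)) ℂ (HolSections n X p)) (u v) :
    conj (basisProduct s u v) = basisProduct s v u := by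
  simp [basisProduct, mul_comm]

theorem eq_zero_of_basisProduct (s : Basis (Fin (dimSections n X p)) ℂ (HolSections n X p)) (u)
    (h : basisProduct s u u = 0) : u = 0 := by
  apply s.repr.injective
  ext j
  have h1 : ∑ j, Complex.normSq (s.repr u j) = 0 := by
    have : ((∑ j, Complex.normSq (s.repr u j) : ℝ) : ℂ) = 0 := by
      rw [← h]; simp [basisProduct, Complex.mul_conj]
    exact_mod_cast this
  rw [Finset.sum_eq_zero_iff_of_nonneg fun _ _ => Complex.normSq_nonneg _] at h1
  simpa using h1 j (Finset.mem_univ j)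

/-- The coherent state projector of a product with an orthonormal basis `s` exists, is unique, and is
given by the usual formula. -/
theorem coherentProjector_basisProduct
    (s : Basis (Fin (dimSections n X p)) ℂ (HolSections n X p)) (x : X) :
    IsCoherentProjector (basisProduct s) x (coherentProjector (basisProduct s) x) ∧
    (∀ P, IsCoherentProjector (basisProduct s) x P → P = coherentProjector (basisProduct s) x) ∧
    ∀ u, coherentProjector (basisProduct s) x u =
      (evalAt n p x u / ∑ j, ‖evalAt n p x (s j)‖ ^ 2 : ℂ) •
        ∑ j, conj (evalAt n p x (s j)) • s j := by
  set ev := evalAt n p x with hev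
  set N : ℝ := ∑ j, ‖ev (s j)‖ ^ 2 with hN
  set e : HolSections n X p := ∑ j, conj (ev (s j)) • s j with he
  have hev1 : ∀ u, ev u = basisProduct s u e := fun u => by
    rw [hev, evalAt_eq_sum s]
    simp only [basisProduct, he, map_sum, map_smul, Finsupp.coe_finsetSum, Finsupp.coe_smul,
      Finset.sum_apply, Pi.smul_apply, Basis.repr_self, smul_eq_mul]
    refine Finset.sum_congr rfl fun j _ => ?_
    congr 1
    rw [← map_sum]
    simp [Finsupp.single_apply, hev]
  have hee : ev e = N := by
    rw [he, map_sum, hN]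
    push_cast
    refine Finset.sum_congr rfl fun j _ => ?_
    rw [map_smul, smul_eq_mul, mul_comm, Complex.mul_conj']
  have hsm : ∀ (c : ℂ) u v, basisProduct s (c • u) v = c * basisProduct s u v := fun c u v => by
    simp [basisProduct, Finset.mul_sum, mul_assoc]
  have hsm2 : ∀ (c : ℂ) u v, basisProduct s u (c • v) = conj c * basisProduct s u v :=
    fun c u v => by
      rw [← basisProduct_conj, hsm, map_mul, basisProduct_conj]
  have h0 : N = 0 → ev = 0 := fun h => by
    have : e = 0 := eq_zero_of_basisProduct s e (by rw [← hev1, hee, h]; simp)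
    ext u
    rw [hev1, this]; simp [basisProduct]
  let P : HolSections n X p →ₗ[ℂ] HolSections n X p :=
    { toFun := fun u => (ev u / N : ℂ) • e
      map_add' := fun u v => by simp [add_div, add_smul]
      map_smul' := fun c u => by simp [mul_div_assoc, mul_smul] }
  have hP : ∀ u, P u = (ev u / N : ℂ) • e := fun _ => rfl
  have hself : ∀ u v, basisProduct s (P u) v = basisProduct s u (P v) := fun u v => by
    rw [hP, hP, hsm, hsm2, ← hev1, ← basisProduct_conj s v e, ← hev1]
    simp; ring
  have hPP : ∀ u, P (P u) = P u := fun u => by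
    rw [hP (P u), hP u, map_smul, hee]
    by_cases h : N = 0
    · simp [h]
    · have : (N : ℂ) ≠ 0 := by exact_mod_cast h
      congr 1
      simp; field_simp
  have hker : ∀ u, P u = 0 ↔ ev u = 0 := fun u => by
    constructor
    · intro h
      by_cases hn : N = 0
      · simp [h0 hn]
      · have : (N : ℂ) ≠ 0 := by exact_mod_cast hn
        have h2 := congrArg ev h
        rw [hP, map_smul, hee, map_zero, smul_eq_mul, div_mul_cancel₀ _ this] at h2
        exact h2
    · intro h
      rw [hP, h]; simp
  have hIs : IsCoherentProjector (basisProduct s) x P := by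
    refine ⟨LinearMap.ext hPP, hself, ?_⟩
    ext u
    exact hker u
  have huniq : ∀ Q, IsCoherentProjector (basisProduct s) x Q → Q = P := by
    rintro Q ⟨hQ1, hQ2, hQ3⟩
    have hQQ : ∀ u, Q (Q u) = Q u := fun u => LinearMap.congr_fun hQ1 u
    have hk : ∀ u, Q u = 0 ↔ ev u = 0 := fun u => by
      rw [← LinearMap.mem_ker, hQ3, LinearMap.mem_ker]
    have hPQ : ∀ u, P (Q u) = P u := fun u => by
      rw [← sub_eq_zero, ← map_sub, hker, ← hk, map_sub, hQQ, sub_self]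
    have hQP : ∀ u, Q (P u) = Q u := fun u => by
      rw [← sub_eq_zero, ← map_sub, hk, ← hker, map_sub, hPP, sub_self]
    ext1 u
    rw [← sub_eq_zero]
    apply eq_zero_of_basisProduct s
    have hadd : ∀ a b c, basisProduct s (a - b) c = basisProduct s a c - basisProduct s b c :=
      fun a b c => by simp [basisProduct, sub_mul, Finset.sum_sub_distrib]
    rw [hadd, hQ2, hself, map_sub, map_sub, hQQ, hQP, hPQ, hPP]
    simp
  have hc : coherentProjector (basisProduct s) x = P :=
    huniq _ (Classical.epsilon_spec (p := IsCoherentProjector (basisProduct s) x) ⟨P, hIs⟩)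
  rw [hc]
  exact ⟨hIs, huniq, hP⟩

/-- The Fubini-Study metric of `H_s` satisfies its defining identity, and `∑ⱼ |s_j|² = 1`. -/
theorem fubiniStudy_basisProduct
    (s : Basis (Fin (dimSections n X p)) ℂ (HolSections n X p)) (x : X)
    (hx : Function.Surjective (evalAt n p x)) :
    (∀ s₁ s₂, fubiniStudy (basisProduct s) x * evalAt n p x s₁ * conj (evalAt n p x s₂) =
      basisProduct s (coherentProjector (basisProduct s) x s₁) s₂) ∧
    fubiniStudy (basisProduct s) x = (∑ j, ‖evalAt n p x (s j)‖ ^ 2)⁻¹ := by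
  obtain ⟨-, -, h⟩ := coherentProjector_basisProduct s x
  set N : ℝ := ∑ j, ‖evalAt n p x (s j)‖ ^ 2 with hN
  have key : ∀ u v, ((N⁻¹ : ℝ) : ℂ) * evalAt n p x u * conj (evalAt n p x v) =
      basisProduct s (coherentProjector (basisProduct s) x u) v := fun u v => by
    rw [h, evalAt_eq_sum s x v]
    simp only [basisProduct, map_smul, map_sum, Finsupp.coe_smul, Pi.smul_apply, smul_eq_mul,
      Finsupp.coe_finsetSum, Finset.sum_apply, Basis.repr_self, Finsupp.single_apply, mul_ite,
      mul_one, mul_zero, Finset.sum_ite_eq', Finset.mem_univ, if_true, map_mul, Finset.mul_sum]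
    refine Finset.sum_congr rfl fun j _ => ?_
    push_cast
    ring
  have hs := Classical.epsilon_spec (p := fun c : ℝ => ∀ s₁ s₂ : HolSections n X p,
    c * evalAt n p x s₁ * conj (evalAt n p x s₂) =
      basisProduct s (coherentProjector (basisProduct s) x s₁) s₂) ⟨_, key⟩
  refine ⟨hs, ?_⟩
  obtain ⟨u, hu⟩ := hx 1
  have h1 := (hs u u).trans (key u u).symm
  rw [hu] at h1
  apply Complex.ofReal_injective
  simpa [fubiniStudy] using h1

variable [T2Space X] [CompactSpace X] [MeasurableSpace X] [BorelSpace X]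

/-- The Hermitian product `L²(h^p)`, for the metric `h` on `K_X^*` given by `w`. -/
def l2Product (p : ℕ) (w : X → ℝ) (s₁ s₂ : HolSections n X p) : ℂ :=
  ∫ x, (w x : ℂ) ^ p * evalAt n p x s₁ * conj (evalAt n p x s₂) ∂(anticanVolume n w)

/-- The Hermitian product `Hilb_ν(h^p)`, for the metric `h` on `K_X^*` given by `w`. -/
def hilbProduct (p : ℕ) (w : X → ℝ) (s₁ s₂ : HolSections n X p) : ℂ :=
  ((dimSections n X p / totalVolume n w : ℝ) : ℂ) * l2Product p w s₁ s₂

/-- `h^p` is balanced with respect to the anticanonical volume form: `FS(Hilb_ν(h^p)) = h^p`. -/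
def HermitianMetric.IsBalanced (h : HermitianMetric n X) (p : ℕ) : Prop :=
  fubiniStudy (n := n) (hilbProduct p h.normSq) = h.normSq ^ p

/-! ### Berezin-Toeplitz quantization -/

/-- The Rawnsley function `ρ_{h^p}`, defined by
`ρ_{h^p}(x) ⟨Π_p(x) s₁, s₂⟩_{L²(h^p)} = ⟨s₁(x), s₂(x)⟩_{h^p}` for all sections `s₁`, `s₂`, where
`Π_p` is the coherent state projector of `L²(h^p)`. -/
def rawnsley (p : ℕ) (w : X → ℝ) (x : X) : ℝ :=
  Classical.epsilon fun r : ℝ => ∀ s₁ s₂ : HolSections n X p,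
    r * l2Product p w (coherentProjector (l2Product p w) x s₁) s₂ =
      (w x : ℂ) ^ p * evalAt n p x s₁ * conj (evalAt n p x s₂)

/-- The integral of a function with values in the endomorphisms of a finite dimensional space:
the matrix entries with respect to a basis `b` are integrated. (The
result does not depend on `b`.) -/
def endIntegral {ι V : Type*} [Fintype ι] [DecidableEq ι] [AddCommGroup V] [Module ℂ V]
    (b : Basis ι ℂ V) (μ : Measure X) (F : X → V →ₗ[ℂ] V) : V →ₗ[ℂ] V :=
  Matrix.toLin b b (Matrix.of fun k j => ∫ x, LinearMap.toMatrix b b (F x) k j ∂μ)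

/-- The Berezin-Toeplitz quantization `T_{h^p}(f) = ∫ f(x) Π_p(x) ρ_{h^p}(x) dν_h(x)`. The basis `b`
only serves to integrate endomorphisms. -/
def toeplitz (b : Basis (Fin (dimSections n X p)) ℂ (HolSections n X p)) (w : X → ℝ) (f : X → ℂ) :
    HolSections n X p →ₗ[ℂ] HolSections n X p :=
  endIntegral b (anticanVolume n w) fun x =>
    (f x * (rawnsley (n := n) p w x : ℂ)) • coherentProjector (l2Product p w) x

/-- The Berezin-Toeplitz quantum channel `E_{h^p}(T) = T_{h^p}(σ_{L²(h^p)}(T))`. -/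
def quantumChannel (b : Basis (Fin (dimSections n X p)) ℂ (HolSections n X p)) (w : X → ℝ)
    (T : HolSections n X p →ₗ[ℂ] HolSections n X p) :
    HolSections n X p →ₗ[ℂ] HolSections n X p :=
  toeplitz b w (berezinSymbol (l2Product p w) T)

/-- The identification of matrices with endomorphisms of `H⁰(X, L^p)` given by a basis `s`, where
`A` acts by `s_j ↦ ∑ₖ A_{jk} s_k`. It identifies the Hermitian matrices with
the endomorphisms that are Hermitian for `H_s`. -/
def endOfMatrix (s : Basis (Fin (dimSections n X p)) ℂ (HolSections n X p)) :
    Matrix (Fin (dimSections n X p)) (Fin (dimSections n X p)) ℂ ≃ₗ[ℂ]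
      (HolSections n X p →ₗ[ℂ] HolSections n X p) :=
  (Matrix.transposeLinearEquiv _ _ ℂ ℂ).trans (Matrix.toLin s s)

/-- The quantum channel acting on matrices, through the identification given by the basis `s`. -/
def quantumChannelMatrix (s : Basis (Fin (dimSections n X p)) ℂ (HolSections n X p)) (w : X → ℝ)
    (A : Matrix (Fin (dimSections n X p)) (Fin (dimSections n X p)) ℂ) :
    Matrix (Fin (dimSections n X p)) (Fin (dimSections n X p)) ℂ :=
  (endOfMatrix s).symm (quantumChannel s w (endOfMatrix s A))

/-! ### The moment map -/

/-- The squared lengths of the frame vectors for the metric `h_s` on `K_X^*`, which is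
the `p`-th root of the metric `h_s^p = FS(H_s)` on `L^p`. -/
def basisMetric (s : Basis (Fin (dimSections n X p)) ℂ (HolSections n X p)) (x : X) : ℝ :=
  fubiniStudy (basisProduct s) x ^ (1 / p : ℝ)

/-- The moment map `μ_ν`, with the entries
`∫ ⟨s_j, s_k⟩_{h_s^p} dν_{h_s} - (Vol(dν_{h_s}) / n_p) δ_{jk}`. -/
def momentMap (s : Basis (Fin (dimSections n X p)) ℂ (HolSections n X p)) :
    Matrix (Fin (dimSections n X p)) (Fin (dimSections n X p)) ℂ :=
  (Matrix.of fun j k => ∫ x, (fubiniStudy (basisProduct s) x : ℂ) * evalAt n p x (s j) *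
      conj (evalAt n p x (s k)) ∂(anticanVolume n (basisMetric s)))
    - ((totalVolume n (basisMetric s) / dimSections n X p : ℝ) : ℂ) • 1

end Products

/-- The action `(G.s)_j = ∑ₖ G_{jk} s_k` of invertible matrices on bases. -/
def glAct {ι V : Type*} [Fintype ι] [DecidableEq ι] [AddCommGroup V] [Module ℂ V]
    (G : (Matrix ι ι ℂ)ˣ) (s : Basis ι ℂ V) : Basis ι ℂ V :=
  s.map (Matrix.toLinearEquiv s G.1.transpose
    (by rw [Matrix.det_transpose]; exact (Matrix.isUnit_iff_isUnit_det _).1 G.isUnit))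

theorem glAct_apply {ι V : Type*} [Fintype ι] [DecidableEq ι] [AddCommGroup V] [Module ℂ V]
    (G : (Matrix ι ι ℂ)ˣ) (s : Basis ι ℂ V) (j : ι) : glAct G s j = ∑ k, G.1 j k • s k := by
  simp [glAct, Matrix.toLin_self]

/-- The curve `t ↦ e^{tA}.s` of bases. -/
def expCurve {ι V : Type*} [Fintype ι] [DecidableEq ι] [AddCommGroup V] [Module ℂ V]
    (A : Matrix ι ι ℂ) (s : Basis ι ℂ V) (t : ℝ) : Basis ι ℂ V :=
  glAct (Matrix.isUnit_exp (t • A)).unit s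

end

end AnticanBalanced

open AnticanBalanced

namespace AnticanBalanced

/-! ### Continuity of pairings, and the anticanonical volume under rescaling of the metric. -/

section Volume

variable {n : ℕ} {X : Type*} [TopologicalSpace X] [ChartedSpace (Fin n → ℂ) X]
  [IsManifold 𝓘(ℂ, Fin n → ℂ) ω X]

/-! Everything reduces to one matrix-valued function. Let `M(x)` be the matrix of the coherent state
projector at `x` in the basis `s`: the rank one projector `v v* / B`, where `v` is the vector of
values `s_j(x)` and `B = ∑ |s_j(x)|²`. Since Hilb is a multiple of the L² product, balancedness says
that `h^p = κ / B` with `κ = n_p / Vol(dν_h)`, i.e. the Bergman kernel is the constant `κ`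
(`HermitianMetric.IsBalanced.normSq_pow_eq`). Hence `M = κ⁻¹ (⟨s_j, s_k⟩_{h^p})`, and orthonormality
gives `∫ M dν_h = κ⁻¹ Id`.

Along the curve `e^{tA} s` the vector `v` becomes `e^{tA} v`, so `M` is replaced by `Q_t = e^{tA} M
e^{tA}`, and the Fubini-Study metric on `L^p` is `h^p / (κ Tr Q_t)`. Its `p`-th root rescales `h`,
and the volume form is linear in the metric, whence `momentMap_expCurve`: the moment map is
`κ^{-1/p} ∫ (Tr Q_t)^{-1/p-1} φ(Q_t) dν_h`, where `φ` is the trace-free part.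

At `t = 0` one has `Tr Q = 1` and `Q' = AM + MA`, so the integrand of the derivative is `-2(1 + 1/p)
Tr(AM) φ(M) + φ(AM + MA)`. The term `1` in `1 + 1/p` comes from normalising the sections, the term
`1/p` from varying the volume form. Pairing with the trace-free `A` removes the projection in `φ`
and leaves `-2(1 + 1/p) Tr(AM)² + 2 Tr(A²M)`. The second term integrates to `2 κ⁻¹ Tr(A²)`; the
first is the channel, because `Tr[A E(A)] = κ ∫ Tr(AM)² dν_h` (`trace_mul_quantumChannelMatrix`).
The factor `κ^{-1/p}` is absorbed by the volume of `dν_s`. -/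

theorem HermitianMetric.continuousOn_frameNormSq (h : HermitianMetric n X)
    (i : atlas (Fin n → ℂ) X) : ContinuousOn (frameNormSq n h.normSq i) i.1.source := by
  refine ((h.smooth i).continuousOn.comp i.1.continuousOn i.1.mapsTo).congr fun x hx => ?_
  simp [i.1.left_inv hx]

/-- The pairing of two holomorphic sections with respect to a Hermitian metric is continuous. -/
theorem HermitianMetric.continuous_pairing (h : HermitianMetric n X) (p : ℕ)
    (u v : HolSections n X p) :
    Continuous fun x => (h.normSq x : ℂ) ^ p * evalAt n p x u * conj (evalAt n p x v) := by
  rw [continuous_iff_continuousAt]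
  intro x₀
  set i : atlas (Fin n → ℂ) X := achart _ x₀ with hi
  set K := anticanonicalBundle n X with hK
  set Z := tensorPower K p with hZ
  have hsrc : i.1.source ∈ nhds x₀ := i.1.open_source.mem_nhds (mem_chart_source _ x₀)
  -- The value `s x` is read in the frame of the preferred chart at `x`, which may jump with `x`. In
  -- the frame of the fixed chart `i` it is continuous.
  have hloc : ∀ s : HolSections n X p,
      ContinuousOn (fun x => Z.coordChange (Z.indexAt x) i x (s x)) i.1.source := by
    intro s
    have h1 : Continuous fun x => (TotalSpace.mk' ℂ x (s x) : TotalSpace ℂ Z.Fiber) :=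
      s.contMDiff.continuous
    have h2 := (Z.localTriv i).continuousOn.comp (s := i.1.source) h1.continuousOn fun x hx => by
      rw [Trivialization.mem_source]
      exact hx
    exact continuous_snd.comp_continuousOn h2
  have hev : ∀ s : HolSections n X p, ∀ x ∈ i.1.source, evalAt n p x s =
      (K.coordChange i (K.indexAt x) x 1) ^ p * Z.coordChange (Z.indexAt x) i x (s x) := by
    intro s x hx
    have h3 := Z.coordChange_comp (Z.indexAt x) i (Z.indexAt x) x
      ⟨⟨Z.mem_baseSet_at x, hx⟩, Z.mem_baseSet_at x⟩ (s x)
    exact (Z.coordChange_self _ _ (Z.mem_baseSet_at x) (s x)).symm.trans h3.symm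
  refine ContinuousOn.continuousAt ?_ hsrc
  -- The transition factor contributes `|g|^{2p}` to the product of the two sections, exactly what
  -- turns `normSq ^ p` into `frameNormSq ^ p`.
  have hc : ContinuousOn (fun x => ((frameNormSq n h.normSq i x : ℝ) : ℂ) ^ p *
      Z.coordChange (Z.indexAt x) i x (u x) * conj (Z.coordChange (Z.indexAt x) i x (v x)))
      i.1.source :=
    ((Complex.continuous_ofReal.comp_continuousOn (h.continuousOn_frameNormSq i)).pow p |>.mul
      (hloc u)).mul (Complex.continuous_conj.comp_continuousOn (hloc v))
  refine hc.congr fun x hx => ?_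
  simp only
  rw [hev u x hx, hev v x hx, frameNormSq]
  push_cast
  rw [← Complex.mul_conj', map_mul, map_pow]
  ring

variable [T2Space X] [CompactSpace X] [MeasurableSpace X] [BorelSpace X]

/-- A compact neighbourhood inside a chart has finite volume, as the integral of a continuous
density over a compact set; compactness of `X` does the rest. -/
theorem HermitianMetric.isFiniteMeasure_anticanVolume (h : HermitianMetric n X) :
    IsFiniteMeasure (anticanVolume n h.normSq) := by
  refine ⟨isCompact_univ.measure_lt_top_of_nhdsWithin fun x _ => ?_⟩
  set i : atlas (Fin n → ℂ) X := achart _ x with hi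
  obtain ⟨K, hK, hKc, hKi⟩ : ∃ K ∈ nhds x, IsCompact K ∧ K ⊆ i.1.source := by
    obtain ⟨K, h1, h2, h3⟩ := local_compact_nhds
      (i.1.open_source.mem_nhds (mem_chart_source _ x))
    exact ⟨K, h1, h3, h2⟩
  refine ⟨K, mem_nhdsWithin_of_mem_nhds hK, ?_⟩
  rw [anticanVolume_apply h.normSq (fun x => (h.pos x).le) h.continuousOn_frameNormSq i K
    hKc.measurableSet hKi]
  have himg : i.1.target ∩ i.1.symm ⁻¹' K = i.1 '' K := by
    rw [← i.1.image_source_inter_eq' K, inter_eq_self_of_subset_right hKi]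
  rw [himg]
  have hcomp : IsCompact (i.1 '' K) := hKc.image_of_continuousOn (i.1.continuousOn.mono hKi)
  have hc : ContinuousOn (fun z => 2 ^ n * frameNormSq n h.normSq i (i.1.symm z)) (i.1 '' K) :=
    continuousOn_const.mul ((h.smooth i).continuousOn.mono
      ((image_mono hKi).trans i.1.mapsTo.image_subset))
  exact (hc.integrableOn_compact hcomp).lintegral_lt_top

/-- The local densities are linear in the metric, so the factor `f` passes through the gluing chart
by chart. -/
theorem HermitianMetric.anticanVolume_mul (h : HermitianMetric n X) (f : X → ℝ)
    (hf : Continuous f) (hf0 : ∀ x, 0 ≤ f x) :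
    anticanVolume n (fun x => f x * h.normSq x) =
      (anticanVolume n h.normSq).withDensity fun x => ENNReal.ofReal (f x) := by
  have hfm : Measurable fun x => ENNReal.ofReal (f x) := hf.measurable.ennreal_ofReal
  ext C hC
  rw [withDensity_apply _ hC]
  unfold anticanVolume
  rw [Measure.restrict_sum _ hC, lintegral_sum_measure, Measure.sum_apply _ hC]
  congr 1
  ext i
  have hm : AEMeasurable (fun x =>
      ENNReal.ofReal (chartPartition n X i x * (2 ^ n * frameNormSq n h.normSq i x)))
      (chartLebesgue n i) := by
    -- The density is known to be continuous only on the source of the chart, which carries all the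
    -- mass of `chartLebesgue`.
    have h1 : (chartLebesgue n i).restrict i.1.source = chartLebesgue n i := by
      refine Measure.restrict_eq_self_of_ae_mem ?_
      refine (ae_map_iff (p := fun x => x ∈ i.1.source)
        (i.1.continuousOn_symm.aemeasurable i.1.open_target.measurableSet)
        i.1.open_source.measurableSet).2 ?_
      filter_upwards [ae_restrict_mem i.1.open_target.measurableSet] with z hz
      exact i.1.map_target hz
    rw [← h1]
    exact (ContinuousOn.aemeasurable ((chartPartition n X i).continuous.continuousOn.mul
      (continuousOn_const.mul (h.continuousOn_frameNormSq i)))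
      i.1.open_source.measurableSet).ennreal_ofReal
  rw [← withDensity_apply _ hC, ← withDensity_mul₀ hm hfm.aemeasurable]
  congr 2
  ext x
  simp only [Pi.mul_apply]
  rw [← ENNReal.ofReal_mul' (hf0 x)]
  congr 1
  simp only [frameNormSq]
  ring

end Volume

/-! ### Coherent state projectors, Rawnsley function and balanced metrics in an orthonormal basis.
-/

section Coherent

variable {n : ℕ} {X : Type*} [TopologicalSpace X] [ChartedSpace (Fin n → ℂ) X]
  [IsManifold 𝓘(ℂ, Fin n → ℂ) ω X] {p : ℕ}

theorem sum_normSq_evalAt_pos (hKod : KodairaMapWellDefined n X p)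
    (s : Basis (Fin (dimSections n X p)) ℂ (HolSections n X p)) (x : X) :
    0 < ∑ j, ‖evalAt n p x (s j)‖ ^ 2 := by
  refine lt_of_le_of_ne (Finset.sum_nonneg fun _ _ => by positivity) fun h0 => ?_
  obtain ⟨u, hu⟩ := hKod x 1
  rw [evalAt_eq_sum s, Finset.sum_eq_zero] at hu
  · exact zero_ne_one hu
  · intro j hj
    have := (Finset.sum_eq_zero_iff_of_nonneg fun _ _ => by positivity).1 h0.symm j hj
    rw [norm_eq_zero.1 (pow_eq_zero_iff two_ne_zero |>.1 this), mul_zero]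

/-- The matrix of the coherent state projector `Π_{H_s}(x)` with respect to the basis `s`. -/
noncomputable def coherentMatrix (s : Basis (Fin (dimSections n X p)) ℂ (HolSections n X p))
    (x : X) : Matrix (Fin (dimSections n X p)) (Fin (dimSections n X p)) ℂ :=
  Matrix.of fun j k => evalAt n p x (s j) * conj (evalAt n p x (s k)) /
    ((∑ l, ‖evalAt n p x (s l)‖ ^ 2 : ℝ) : ℂ)

theorem isHermitian_coherentMatrix
    (s : Basis (Fin (dimSections n X p)) ℂ (HolSections n X p)) (x : X) :
    (coherentMatrix s x).IsHermitian := by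
  ext j k
  simp [coherentMatrix, mul_comm]

theorem endOfMatrix_eq (s : Basis (Fin (dimSections n X p)) ℂ (HolSections n X p))
    (A : Matrix (Fin (dimSections n X p)) (Fin (dimSections n X p)) ℂ) :
    endOfMatrix s A = Matrix.toLin s s A.transpose := rfl

theorem coherentProjector_eq_endOfMatrix
    (s : Basis (Fin (dimSections n X p)) ℂ (HolSections n X p)) (x : X) :
    coherentProjector (basisProduct s) x = endOfMatrix s (coherentMatrix s x) := by
  refine s.ext fun j => ?_
  rw [(coherentProjector_basisProduct s x).2.2]
  simp only [endOfMatrix_eq, Matrix.toLin_self, Matrix.transpose_apply, coherentMatrix, Matrix.of_apply, Finset.smul_sum,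
    smul_smul]
  refine Finset.sum_congr rfl fun k _ => ?_
  congr 1
  push_cast
  ring

theorem berezinSymbol_endOfMatrix
    (s : Basis (Fin (dimSections n X p)) ℂ (HolSections n X p)) (x : X)
    (A : Matrix (Fin (dimSections n X p)) (Fin (dimSections n X p)) ℂ) :
    berezinSymbol (basisProduct s) (endOfMatrix s A) x = (A * coherentMatrix s x).trace := by
  rw [berezinSymbol, coherentProjector_eq_endOfMatrix, LinearMap.trace_eq_matrix_trace ℂ s,
    LinearMap.toMatrix_comp s s s]
  -- The identification transposes matrices and so reverses products; the trace does not see this.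
  rw [endOfMatrix_eq, endOfMatrix_eq, LinearMap.toMatrix_toLin, LinearMap.toMatrix_toLin, ← Matrix.transpose_mul, Matrix.trace_transpose, Matrix.trace_mul_comm]

/-- Rescaling a product does not change orthogonality. This passes from L² to Hilb. -/
theorem coherentProjector_const_mul (H : HolSections n X p → HolSections n X p → ℂ) {c : ℂ}
    (hc : c ≠ 0) (x : X) :
    coherentProjector (fun u v => c * H u v) x = coherentProjector H x := by
  unfold coherentProjector
  congr 1
  ext P
  simp [IsCoherentProjector, hc]

theorem fubiniStudy_const_mul (hKod : KodairaMapWellDefined n X p)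
    (s : Basis (Fin (dimSections n X p)) ℂ (HolSections n X p)) (c : ℝ) (hc : c ≠ 0) (x : X) :
    fubiniStudy (fun u v => (c : ℂ) * basisProduct s u v) x =
      c * (∑ j, ‖evalAt n p x (s j)‖ ^ 2)⁻¹ := by
  obtain ⟨h1, h2⟩ := fubiniStudy_basisProduct s x (hKod x)
  have hc' : (c : ℂ) ≠ 0 := by exact_mod_cast hc
  have key : ∀ u v, ((c * fubiniStudy (basisProduct s) x : ℝ) : ℂ) * evalAt n p x u *
      conj (evalAt n p x v) =
      c * basisProduct s (coherentProjector (fun u v => (c : ℂ) * basisProduct s u v) x u) v := by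
    intro u v
    rw [coherentProjector_const_mul _ hc', ← h1]
    push_cast
    ring
  have hs := Classical.epsilon_spec (p := fun r : ℝ => ∀ s₁ s₂ : HolSections n X p,
    r * evalAt n p x s₁ * conj (evalAt n p x s₂) =
      c * basisProduct s (coherentProjector (fun u v => (c : ℂ) * basisProduct s u v) x s₁) s₂)
    ⟨_, key⟩
  -- The constant chosen by `epsilon` is pinned down by testing on a section with value `1` at `x`.
  obtain ⟨u, hu⟩ := hKod x 1
  have h3 := (hs u u).trans (key u u).symm
  rw [hu] at h3
  rw [← h2]
  apply Complex.ofReal_injective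
  simpa [fubiniStudy] using h3

variable [T2Space X] [CompactSpace X] [MeasurableSpace X] [BorelSpace X]

theorem HermitianMetric.integrable_of_continuous (h : HermitianMetric n X) {E : Type*}
    [NormedAddCommGroup E] [SecondCountableTopologyEither X E] {f : X → E} (hf : Continuous f) :
    Integrable f (anticanVolume n h.normSq) := by
  have := h.isFiniteMeasure_anticanVolume
  obtain ⟨C, hC⟩ := isCompact_univ.exists_bound_of_continuousOn hf.continuousOn
  exact .of_bound hf.aestronglyMeasurable C (ae_of_all _ fun x => hC x (mem_univ x))

/-- Both products are sesquilinear and agree on `s`. The explicit formulas for products with a given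
orthonormal basis thus apply to L². -/
theorem HermitianMetric.l2Product_eq_basisProduct (h : HermitianMetric n X)
    (s : Basis (Fin (dimSections n X p)) ℂ (HolSections n X p))
    (hs : ∀ j k, l2Product p h.normSq (s j) (s k) = if j = k then 1 else 0) :
    l2Product p h.normSq = basisProduct s := by
  ext u v
  have h1 : ∀ x, (h.normSq x : ℂ) ^ p * evalAt n p x u * conj (evalAt n p x v) =
      ∑ j, ∑ k, (s.repr u j * conj (s.repr v k)) *
        ((h.normSq x : ℂ) ^ p * evalAt n p x (s j) * conj (evalAt n p x (s k))) := by
    intro x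
    rw [evalAt_eq_sum s x u, evalAt_eq_sum s x v, map_sum, mul_assoc, Finset.sum_mul_sum,
      Finset.mul_sum]
    refine Finset.sum_congr rfl fun j _ => ?_
    rw [Finset.mul_sum]
    refine Finset.sum_congr rfl fun k _ => ?_
    rw [map_mul]
    ring
  have h2 : ∀ j k, Integrable (fun x => (s.repr u j * conj (s.repr v k)) *
      ((h.normSq x : ℂ) ^ p * evalAt n p x (s j) * conj (evalAt n p x (s k))))
      (anticanVolume n h.normSq) := fun j k =>
    (h.integrable_of_continuous (h.continuous_pairing p (s j) (s k))).const_mul _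
  rw [l2Product]
  simp_rw [h1]
  rw [integral_finsetSum _ fun j _ => integrable_finsetSum _ fun k _ => h2 j k]
  rw [basisProduct]
  refine Finset.sum_congr rfl fun j _ => ?_
  rw [integral_finsetSum _ fun k _ => h2 j k]
  simp_rw [integral_const_mul]
  change ∑ k, s.repr u j * conj (s.repr v k) * l2Product p h.normSq (s j) (s k) = _
  simp [hs]

/-- The Bergman kernel of a balanced metric is constant. -/
theorem HermitianMetric.IsBalanced.normSq_pow_eq {h : HermitianMetric n X} (hbal : h.IsBalanced p)
    (hKod : KodairaMapWellDefined n X p)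
    (s : Basis (Fin (dimSections n X p)) ℂ (HolSections n X p))
    (hs : ∀ j k, l2Product p h.normSq (s j) (s k) = if j = k then 1 else 0)
    (hV : totalVolume n h.normSq ≠ 0) (hN : dimSections n X p ≠ 0) (x : X) :
    h.normSq x ^ p = dimSections n X p / totalVolume n h.normSq *
      (∑ j, ‖evalAt n p x (s j)‖ ^ 2)⁻¹ := by
  have hc : (dimSections n X p / totalVolume n h.normSq : ℝ) ≠ 0 :=
    div_ne_zero (by exact_mod_cast hN) hV
  rw [← fubiniStudy_const_mul hKod s _ hc, ← h.l2Product_eq_basisProduct s hs]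
  exact (congrFun hbal x).symm

/-- Pairing with the projector gives the Fubini-Study metric `1 / B`, so the ratio to `h^p` is the
Bergman kernel `h^p B`. -/
theorem HermitianMetric.rawnsley_eq (h : HermitianMetric n X)
    (hKod : KodairaMapWellDefined n X p)
    (s : Basis (Fin (dimSections n X p)) ℂ (HolSections n X p))
    (hs : ∀ j k, l2Product p h.normSq (s j) (s k) = if j = k then 1 else 0) (x : X) :
    rawnsley (n := n) p h.normSq x = h.normSq x ^ p * ∑ j, ‖evalAt n p x (s j)‖ ^ 2 := by
  obtain ⟨h1, h2⟩ := fubiniStudy_basisProduct s x (hKod x)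
  have hB := (sum_normSq_evalAt_pos hKod s x).ne'
  have hB' : ((∑ j, ‖evalAt n p x (s j)‖ ^ 2 : ℝ) : ℂ) ≠ 0 := by exact_mod_cast hB
  have key : ∀ u v, ((h.normSq x ^ p * ∑ j, ‖evalAt n p x (s j)‖ ^ 2 : ℝ) : ℂ) *
      l2Product p h.normSq (coherentProjector (l2Product p h.normSq) x u) v =
      (h.normSq x : ℂ) ^ p * evalAt n p x u * conj (evalAt n p x v) := by
    intro u v
    rw [h.l2Product_eq_basisProduct s hs, ← h1, h2, Complex.ofReal_mul, Complex.ofReal_inv]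
    push_cast at hB' ⊢
    field_simp
  have hs := Classical.epsilon_spec (p := fun r : ℝ => ∀ s₁ s₂ : HolSections n X p,
    r * l2Product p h.normSq (coherentProjector (l2Product p h.normSq) x s₁) s₂ =
      (h.normSq x : ℂ) ^ p * evalAt n p x s₁ * conj (evalAt n p x s₂)) ⟨_, key⟩
  obtain ⟨u, hu⟩ := hKod x 1
  have h3 := (hs u u).trans (key u u).symm
  -- Uniqueness of the Rawnsley constant needs a pair of sections on which its coefficient does not
  -- vanish.
  have hne : l2Product p h.normSq (coherentProjector (l2Product p h.normSq) x u) u ≠ 0 := by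
    intro h0
    have := hs u u
    rw [h0, hu] at this
    have hw : (h.normSq x : ℂ) ≠ 0 := by exact_mod_cast (h.pos x).ne'
    simp only [mul_zero, map_one, mul_one] at this
    exact pow_ne_zero p hw this.symm
  apply Complex.ofReal_injective
  exact mul_right_cancel₀ hne h3

end Coherent

/-! ### Differentiation under the integral and of matrix exponentials. -/

section Calculus

/-- Joint continuity bounds the derivative uniformly on the compact set `[-1, 1] × X`, and a
constant is integrable for a finite measure. -/
theorem hasDerivAt_integral_of_compact {X : Type*} [TopologicalSpace X] [CompactSpace X]
    [MeasurableSpace X] [BorelSpace X] (μ : Measure X) [IsFiniteMeasure μ] (f f' : ℝ → X → ℂ)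
    (hd : ∀ t x, HasDerivAt (fun t => f t x) (f' t x) t) (hf : ∀ t, Continuous (f t))
    (hf' : Continuous (Function.uncurry f')) :
    HasDerivAt (fun t => ∫ x, f t x ∂μ) (∫ x, f' 0 x ∂μ) 0 := by
  obtain ⟨C, hC⟩ := ((isCompact_Icc (a := (-1 : ℝ)) (b := 1)).prod
    (isCompact_univ (X := X))).exists_bound_of_continuousOn hf'.continuousOn
  have hf'0 : ∀ t, Continuous (f' t) := fun t => hf'.comp (.prodMk_right t)
  obtain ⟨C₀, hC₀⟩ := isCompact_univ.exists_bound_of_continuousOn (hf 0).continuousOn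
  refine (hasDerivAt_integral_of_dominated_loc_of_deriv_le (bound := fun _ => C)
    (Icc_mem_nhds (by norm_num : (-1 : ℝ) < 0) one_pos)
    (.of_forall fun t => (hf t).aestronglyMeasurable)
    (.of_bound (hf 0).aestronglyMeasurable C₀ (ae_of_all _ fun x => hC₀ x (mem_univ x)))
    (hf'0 0).aestronglyMeasurable ?_ (integrable_const C) ?_).2
  · exact ae_of_all _ fun x t ht => hC (t, x) ⟨ht, mem_univ x⟩
  · exact ae_of_all _ fun x t _ => hd t x

variable {ι : Type*} [Fintype ι]

open scoped Matrix.Norms.Operator in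
theorem hasDerivAt_exp_mul_mul_exp [DecidableEq ι] (A M : Matrix ι ι ℂ) (t : ℝ) (j k : ι) :
    HasDerivAt (fun t : ℝ => (NormedSpace.exp (t • A) * M * NormedSpace.exp (t • A)) j k)
      ((A * (NormedSpace.exp (t • A) * M * NormedSpace.exp (t • A)) +
        NormedSpace.exp (t • A) * M * NormedSpace.exp (t • A) * A) j k) t := by
  -- Since `A` commutes with `e^{tA}`, it can be placed on the right for the right-hand exponential
  -- and on the left for the left-hand one.
  have h1 := hasDerivAt_exp_smul_const (𝕂 := ℝ) A t
  have h2 := hasDerivAt_exp_smul_const' (𝕂 := ℝ) A t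
  have h3 := (h2.mul_const M).mul h1
  have h4 := hasDerivAt_pi.1 (hasDerivAt_pi.1 h3 j) k
  have e : A * (NormedSpace.exp (t • A) * M * NormedSpace.exp (t • A)) +
        NormedSpace.exp (t • A) * M * NormedSpace.exp (t • A) * A =
      A * NormedSpace.exp (t • A) * M * NormedSpace.exp (t • A) +
        NormedSpace.exp (t • A) * M * (NormedSpace.exp (t • A) * A) := by
    simp only [mul_assoc]
  rw [e]
  exact h4

open scoped Matrix.Norms.Operator in
theorem hasDerivAt_linearMap_comp (φ : Matrix ι ι ℂ →ₗ[ℂ] ℂ) {Q : ℝ → Matrix ι ι ℂ}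
    {Q' : Matrix ι ι ℂ} {t : ℝ} (hQ : ∀ j k, HasDerivAt (fun t => Q t j k) (Q' j k) t) :
    HasDerivAt (fun t => φ (Q t)) (φ Q') t := by
  have hQ' : HasDerivAt Q Q' t := hasDerivAt_pi.2 fun j => hasDerivAt_pi.2 fun k => hQ j k
  exact (φ.toContinuousLinearMap.restrictScalars ℝ).hasFDerivAt.comp_hasDerivAt t hQ'

open scoped Matrix.Norms.Operator in
theorem continuous_exp_smul [DecidableEq ι] (A : Matrix ι ι ℂ) :
    Continuous fun t : ℝ => NormedSpace.exp (t • A) :=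
  continuous_iff_continuousAt.2 fun t => (hasDerivAt_exp_smul_const (𝕂 := ℝ) A t).continuousAt

theorem continuous_exp_mul_mul_exp [DecidableEq ι] {X : Type*} [TopologicalSpace X] (A : Matrix ι ι ℂ)
    {M : X → Matrix ι ι ℂ} (hM : Continuous M) :
    Continuous fun q : ℝ × X => NormedSpace.exp (q.1 • A) * M q.2 * NormedSpace.exp (q.1 • A) :=
  (((continuous_exp_smul A).comp continuous_fst).mul (hM.comp continuous_snd)).mul
    ((continuous_exp_smul A).comp continuous_fst)

/-- Differentiation under the integral of `(Tr Q) ^ q φ(Q)`, for a linear form `φ`. -/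
theorem hasDerivAt_integral_rpow_trace_mul {X : Type*} [TopologicalSpace X] [CompactSpace X]
    [MeasurableSpace X] [BorelSpace X] (μ : Measure X) [IsFiniteMeasure μ]
    (Q Q' : ℝ → X → Matrix ι ι ℂ) (hQ : Continuous fun z : ℝ × X => Q z.1 z.2)
    (hQ' : Continuous fun z : ℝ × X => Q' z.1 z.2)
    (hd : ∀ t x j k, HasDerivAt (fun t => Q t x j k) (Q' t x j k) t)
    (hpos : ∀ t x, 0 < (Q t x).trace.re) (q : ℝ) (φ : Matrix ι ι ℂ →ₗ[ℂ] ℂ) :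
    HasDerivAt (fun t : ℝ => ∫ x, (((Q t x).trace.re ^ q : ℝ) : ℂ) * φ (Q t x) ∂μ)
      (∫ x, (((Q' 0 x).trace.re * q * (Q 0 x).trace.re ^ (q - 1) : ℝ) : ℂ) * φ (Q 0 x) +
        (((Q 0 x).trace.re ^ q : ℝ) : ℂ) * φ (Q' 0 x) ∂μ) 0 := by
  have hφc : Continuous φ := φ.continuous_of_finiteDimensional
  have hφd : ∀ t x, HasDerivAt (fun t => φ (Q t x)) (φ (Q' t x)) t := fun t x =>
    hasDerivAt_linearMap_comp φ (hd t x)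
  have hrd : ∀ t x, HasDerivAt (fun t => (Q t x).trace.re) (Q' t x).trace.re t := by
    intro t x
    have : HasDerivAt (fun t => (Q t x).trace) (Q' t x).trace t :=
      hasDerivAt_linearMap_comp (Matrix.traceLinearMap ι ℂ ℂ) (hd t x)
    exact Complex.reCLM.hasFDerivAt.comp_hasDerivAt t this
  have hrc : Continuous fun z : ℝ × X => (Q z.1 z.2).trace.re :=
    Complex.continuous_re.comp hQ.matrix_trace
  have hrc' : ∀ q : ℝ, Continuous fun z : ℝ × X => (Q z.1 z.2).trace.re ^ q := fun q =>
    hrc.rpow_const fun z => .inl (hpos z.1 z.2).ne'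
  refine hasDerivAt_integral_of_compact μ
    (fun t x => (((Q t x).trace.re ^ q : ℝ) : ℂ) * φ (Q t x))
    (fun t x => (((Q' t x).trace.re * q * (Q t x).trace.re ^ (q - 1) : ℝ) : ℂ) *
      φ (Q t x) + (((Q t x).trace.re ^ q : ℝ) : ℂ) * φ (Q' t x))
    (fun t x => (((hrd t x).rpow_const (.inl (hpos t x).ne')).ofReal_comp).mul (hφd t x))
    (fun t => ((Complex.continuous_ofReal.comp (hrc' q)).mul (hφc.comp hQ)).comp
      (.prodMk_right t)) ?_
  refine .add (.mul (Complex.continuous_ofReal.comp (.mul (.mul ?_ continuous_const) (hrc' _)))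
    (hφc.comp hQ)) (.mul (Complex.continuous_ofReal.comp (hrc' q)) (hφc.comp hQ'))
  exact Complex.continuous_re.comp hQ'.matrix_trace

end Calculus

/-! ### The moment map along `e^{tA} s` as an integral against the fixed volume form. -/

section MomentMap

variable {n : ℕ} {X : Type*} [TopologicalSpace X] [ChartedSpace (Fin n → ℂ) X]
  [IsManifold 𝓘(ℂ, Fin n → ℂ) ω X] {p : ℕ}

/-- The vector `v` of values of the basis becomes `e^{tA} v`, so `v v*` becomes `e^{tA} v v*
e^{tA}`, the exponential of a Hermitian matrix being Hermitian. -/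
theorem evalAt_expCurve_mul_conj (hKod : KodairaMapWellDefined n X p)
    (s : Basis (Fin (dimSections n X p)) ℂ (HolSections n X p))
    {A : Matrix (Fin (dimSections n X p)) (Fin (dimSections n X p)) ℂ} (hA : A.IsHermitian)
    (t : ℝ) (x : X) (j k : Fin (dimSections n X p)) :
    evalAt n p x (expCurve A s t j) * conj (evalAt n p x (expCurve A s t k)) =
      ((∑ l, ‖evalAt n p x (s l)‖ ^ 2 : ℝ) : ℂ) *
        (NormedSpace.exp (t • A) * coherentMatrix s x * NormedSpace.exp (t • A)) j k := by
  have hB : ((∑ l, ‖evalAt n p x (s l)‖ ^ 2 : ℝ) : ℂ) ≠ 0 := by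
    exact_mod_cast (sum_normSq_evalAt_pos hKod s x).ne'
  have hE : (NormedSpace.exp (t • A)).IsHermitian :=
    Matrix.IsHermitian.exp (by simp [Matrix.IsHermitian, Matrix.conjTranspose_smul, hA.eq])
  have hev : ∀ j, evalAt n p x (expCurve A s t j) =
      ∑ l, NormedSpace.exp (t • A) j l * evalAt n p x (s l) := fun j => by
    rw [expCurve, glAct_apply, map_sum]
    simp
  rw [hev, hev, map_sum, Finset.sum_mul_sum, Finset.sum_comm, Matrix.mul_apply, Finset.mul_sum]
  refine Finset.sum_congr rfl fun m _ => ?_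
  rw [Matrix.mul_apply, Finset.sum_mul, Finset.mul_sum]
  refine Finset.sum_congr rfl fun l _ => ?_
  rw [map_mul, ← hE.apply m k, coherentMatrix, Matrix.of_apply]
  simp only [RCLike.star_def]
  field_simp

theorem trace_exp_coherentMatrix (hKod : KodairaMapWellDefined n X p)
    (s : Basis (Fin (dimSections n X p)) ℂ (HolSections n X p))
    {A : Matrix (Fin (dimSections n X p)) (Fin (dimSections n X p)) ℂ} (hA : A.IsHermitian)
    (t : ℝ) (x : X) :
    (NormedSpace.exp (t • A) * coherentMatrix s x * NormedSpace.exp (t • A)).trace =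
      (((∑ l, ‖evalAt n p x (expCurve A s t l)‖ ^ 2) / ∑ l, ‖evalAt n p x (s l)‖ ^ 2 : ℝ) : ℂ) := by
  have hB : ((∑ l, ‖evalAt n p x (s l)‖ ^ 2 : ℝ) : ℂ) ≠ 0 := by
    exact_mod_cast (sum_normSq_evalAt_pos hKod s x).ne'
  rw [Complex.ofReal_div, eq_div_iff hB, mul_comm, Matrix.trace, Finset.mul_sum]
  push_cast
  refine Finset.sum_congr rfl fun l _ => ?_
  rw [Matrix.diag_apply, ← Complex.mul_conj', evalAt_expCurve_mul_conj hKod s hA]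
  push_cast
  rfl

theorem trace_coherentMatrix (hKod : KodairaMapWellDefined n X p)
    (s : Basis (Fin (dimSections n X p)) ℂ (HolSections n X p)) (x : X) :
    (coherentMatrix s x).trace = 1 := by
  have hB : ((∑ l, ‖evalAt n p x (s l)‖ ^ 2 : ℝ) : ℂ) ≠ 0 := by
    exact_mod_cast (sum_normSq_evalAt_pos hKod s x).ne'
  simp only [Matrix.trace, Matrix.diag_apply, coherentMatrix, Matrix.of_apply,
    ← Finset.sum_div, Complex.mul_conj']
  rw [div_eq_one_iff_eq hB]
  push_cast
  rfl

variable [T2Space X] [CompactSpace X] [MeasurableSpace X] [BorelSpace X]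

theorem HermitianMetric.integral_anticanVolume_mul (h : HermitianMetric n X) (f : X → ℝ)
    (hf : Continuous f) (hf0 : ∀ x, 0 ≤ f x) (g : X → ℂ) :
    ∫ x, g x ∂(anticanVolume n fun x => f x * h.normSq x) =
      ∫ x, (f x : ℂ) * g x ∂(anticanVolume n h.normSq) := by
  rw [h.anticanVolume_mul f hf hf0, integral_withDensity_eq_integral_toReal_smul
    hf.measurable.ennreal_ofReal (ae_of_all _ fun x => ENNReal.ofReal_lt_top)]
  refine integral_congr_ae (ae_of_all _ fun x => ?_)
  simp [ENNReal.toReal_ofReal (hf0 x)]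

theorem HermitianMetric.totalVolume_mul (h : HermitianMetric n X) (f : X → ℝ)
    (hf : Continuous f) (hf0 : ∀ x, 0 ≤ f x) :
    ((totalVolume n fun x => f x * h.normSq x : ℝ) : ℂ) =
      ∫ x, (f x : ℂ) ∂(anticanVolume n h.normSq) := by
  have := h.integral_anticanVolume_mul f hf hf0 fun _ => 1
  simpa [totalVolume] using this

/-- The linear form `Q ↦ Q_{jk} - (Tr Q / N) δ_{jk}`. -/
noncomputable def tracelessEntry {N : ℕ} (j k : Fin N) : Matrix (Fin N) (Fin N) ℂ →ₗ[ℂ] ℂ :=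
  Matrix.entryLinearMap ℂ ℂ j k -
    ((N : ℂ)⁻¹ * (1 : Matrix (Fin N) (Fin N) ℂ) j k) • Matrix.traceLinearMap (Fin N) ℂ ℂ

theorem tracelessEntry_apply {N : ℕ} (j k : Fin N) (Q : Matrix (Fin N) (Fin N) ℂ) :
    tracelessEntry j k Q = Q j k - (N : ℂ)⁻¹ * (1 : Matrix (Fin N) (Fin N) ℂ) j k * Q.trace := rfl

/-- The scalar part of `Q` pairs with `A` to a multiple of `Tr A = 0`. -/
theorem sum_mul_tracelessEntry {N : ℕ} {A : Matrix (Fin N) (Fin N) ℂ} (hA : A.trace = 0)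
    (Q : Matrix (Fin N) (Fin N) ℂ) :
    ∑ j, ∑ k, A j k * tracelessEntry k j Q = (A * Q).trace := by
  have h1 : ∀ j k, A j k * tracelessEntry k j Q =
      A j k * Q k j - (N : ℂ)⁻¹ * Q.trace * (A j k * (1 : Matrix (Fin N) (Fin N) ℂ) k j) :=
    fun j k => by rw [tracelessEntry_apply]; ring
  simp_rw [h1, Finset.sum_sub_distrib, ← Finset.mul_sum, ← Matrix.mul_apply]
  change (A * Q).trace - _ * (A * 1).trace = _
  rw [mul_one, hA, mul_zero, sub_zero]

/-- The Kodaira map of `L^p` is well defined, the basis `s` is orthonormal for `L²(h^p)`, and the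
Bergman kernel of `h^p` is the constant `κ > 0`. -/
structure IsConstantBergman (h : HermitianMetric n X)
    (s : Basis (Fin (dimSections n X p)) ℂ (HolSections n X p)) (κ : ℝ) : Prop where
  kodaira : KodairaMapWellDefined n X p
  orthonormal : ∀ j k, l2Product p h.normSq (s j) (s k) = if j = k then 1 else 0
  pos : 0 < κ
  bergman : ∀ x, h.normSq x ^ p = κ * (∑ j, ‖evalAt n p x (s j)‖ ^ 2)⁻¹

variable {h : HermitianMetric n X} {s : Basis (Fin (dimSections n X p)) ℂ (HolSections n X p)}
  {κ : ℝ} {A : Matrix (Fin (dimSections n X p)) (Fin (dimSections n X p)) ℂ}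

namespace IsConstantBergman

omit [BorelSpace X] in
-- A constant Bergman kernel means `1 / B = κ⁻¹ h^p`. The normalised matrix thus becomes a pairing
-- of sections, which is continuous and has known integrals.
theorem coherentMatrix_apply (hc : IsConstantBergman h s κ) (x : X)
    (j k : Fin (dimSections n X p)) : coherentMatrix s x j k = (κ : ℂ)⁻¹ *
      ((h.normSq x : ℂ) ^ p * evalAt n p x (s j) * conj (evalAt n p x (s k))) := by
  have hκ : (κ : ℂ) ≠ 0 := by exact_mod_cast hc.pos.ne'
  rw [← Complex.ofReal_pow, hc.bergman x, coherentMatrix, Matrix.of_apply, Complex.ofReal_mul,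
    Complex.ofReal_inv]
  field_simp

omit [BorelSpace X] in
theorem continuous_coherentMatrix (hc : IsConstantBergman h s κ) :
    Continuous (coherentMatrix s) := by
  refine continuous_matrix fun j k => ?_
  simp_rw [hc.coherentMatrix_apply]
  exact continuous_const.mul (h.continuous_pairing p (s j) (s k))

omit [BorelSpace X] in
theorem integral_coherentMatrix (hc : IsConstantBergman h s κ) (j k : Fin (dimSections n X p)) :
    ∫ x, coherentMatrix s x j k ∂(anticanVolume n h.normSq) =
      (κ : ℂ)⁻¹ * (1 : Matrix (Fin (dimSections n X p)) (Fin (dimSections n X p)) ℂ) j k := by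
  simp_rw [hc.coherentMatrix_apply, integral_const_mul]
  rw [Matrix.one_apply, ← hc.orthonormal j k, l2Product]

theorem integral_trace_mul_coherentMatrix (hc : IsConstantBergman h s κ)
    (T : Matrix (Fin (dimSections n X p)) (Fin (dimSections n X p)) ℂ) :
    ∫ x, (T * coherentMatrix s x).trace ∂(anticanVolume n h.normSq) = (κ : ℂ)⁻¹ * T.trace := by
  have hi : ∀ j k, Integrable (fun x => T j k * coherentMatrix s x k j)
      (anticanVolume n h.normSq) := fun j k =>
    h.integrable_of_continuous (continuous_const.mul (hc.continuous_coherentMatrix.matrix_elem k j))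
  simp only [Matrix.trace, Matrix.diag_apply, Matrix.mul_apply]
  rw [integral_finsetSum _ fun j _ => integrable_finsetSum _ fun k _ => hi j k, Finset.mul_sum]
  refine Finset.sum_congr rfl fun j _ => ?_
  rw [integral_finsetSum _ fun k _ => hi j k]
  simp_rw [integral_const_mul, hc.integral_coherentMatrix]
  simp [Matrix.one_apply, mul_comm]

omit [BorelSpace X] in
theorem trace_exp_pos (hc : IsConstantBergman h s κ) (hA : A.IsHermitian) (t : ℝ) (x : X) :
    0 < (NormedSpace.exp (t • A) * coherentMatrix s x * NormedSpace.exp (t • A)).trace.re := by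
  rw [trace_exp_coherentMatrix hc.kodaira s hA, Complex.ofReal_re]
  exact div_pos (sum_normSq_evalAt_pos hc.kodaira _ x) (sum_normSq_evalAt_pos hc.kodaira _ x)

omit [BorelSpace X] in
-- The Fubini-Study metric is the inverse of the sum for `e^{tA} s`, which is `B Tr Q_t`; substitute
-- `B = κ / h^p` and take the `p`-th root.
theorem basisMetric_expCurve (hc : IsConstantBergman h s κ) (hp : 0 < p) (hA : A.IsHermitian)
    (t : ℝ) : basisMetric (expCurve A s t) = fun x => (κ ^ (-(1 / p : ℝ)) *
      (NormedSpace.exp (t • A) * coherentMatrix s x * NormedSpace.exp (t • A)).trace.re ^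
        (-(1 / p : ℝ))) * h.normSq x := by
  ext x
  have hB := sum_normSq_evalAt_pos hc.kodaira s x
  have hBt := sum_normSq_evalAt_pos hc.kodaira (expCurve A s t) x
  rw [basisMetric, (fubiniStudy_basisProduct _ x (hc.kodaira x)).2,
    trace_exp_coherentMatrix hc.kodaira s hA, Complex.ofReal_re]
  have hw : h.normSq x = (h.normSq x ^ p) ^ (1 / p : ℝ) := by
    rw [one_div, Real.pow_rpow_inv_natCast (h.pos x).le hp.ne']
  rw [hw, hc.bergman x, Real.rpow_neg hc.pos.le, Real.rpow_neg (div_pos hBt hB).le,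
    ← Real.inv_rpow hc.pos.le, ← Real.inv_rpow (div_pos hBt hB).le,
    ← Real.mul_rpow (inv_pos.2 hc.pos).le (inv_pos.2 (div_pos hBt hB)).le,
    ← Real.mul_rpow (mul_pos (inv_pos.2 hc.pos) (inv_pos.2 (div_pos hBt hB))).le
      (mul_pos hc.pos (inv_pos.2 hB)).le]
  congr 1
  have := hc.pos.ne'
  field_simp

/-- The pairing of the new sections is `Q_{jk} / Tr Q` and the new volume form is `c (Tr Q)^q dν_h`.
The entry term and the volume term then share the factor `(Tr Q)^{q-1}`. -/
theorem momentMap_eq_integral (hc : IsConstantBergman h s κ) {c : ℝ} (hc0 : 0 < c) (q : ℝ)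
    (s' : Basis (Fin (dimSections n X p)) ℂ (HolSections n X p))
    {Q : X → Matrix (Fin (dimSections n X p)) (Fin (dimSections n X p)) ℂ} (hQ : Continuous Q)
    (hr : ∀ x, 0 < (Q x).trace.re)
    (htr : ∀ x, (Q x).trace = (((∑ l, ‖evalAt n p x (s' l)‖ ^ 2) /
      ∑ l, ‖evalAt n p x (s l)‖ ^ 2 : ℝ) : ℂ))
    (hev : ∀ x j k, evalAt n p x (s' j) * conj (evalAt n p x (s' k)) =
      ((∑ l, ‖evalAt n p x (s l)‖ ^ 2 : ℝ) : ℂ) * Q x j k)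
    (hm : basisMetric s' = fun x => (c * (Q x).trace.re ^ q) * h.normSq x)
    (j k : Fin (dimSections n X p)) :
    momentMap s' j k = (c : ℂ) * ∫ x, (((Q x).trace.re ^ (q - 1) : ℝ) : ℂ) *
      tracelessEntry j k (Q x) ∂(anticanVolume n h.normSq) := by
  have hrc : Continuous fun x => (Q x).trace.re := Complex.continuous_re.comp hQ.matrix_trace
  have hfc : Continuous fun x => c * (Q x).trace.re ^ q :=
    continuous_const.mul (hrc.rpow_const fun x => .inl (hr x).ne')
  have hf0 : ∀ x, 0 ≤ c * (Q x).trace.re ^ q := fun x =>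
    mul_nonneg hc0.le (Real.rpow_nonneg (hr x).le _)
  have htr' : ∀ x, (Q x).trace = ((Q x).trace.re : ℂ) := fun x => by
    rw [htr, Complex.ofReal_re]
  -- The spare factor `Tr Q` cancels the denominator of the pairing and, in the volume term, becomes
  -- the trace in `tracelessEntry`.
  have hpow : ∀ x, (Q x).trace.re ^ q = (Q x).trace.re ^ (q - 1) * (Q x).trace.re := fun x => by
    rw [Real.rpow_sub_one (hr x).ne', div_mul_cancel₀ _ (hr x).ne']
  have hFS : ∀ x, (fubiniStudy (basisProduct s') x : ℂ) *
      evalAt n p x (s' j) * conj (evalAt n p x (s' k)) =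
      ((Q x).trace.re : ℂ)⁻¹ * Q x j k := fun x => by
    have hB : ((∑ l, ‖evalAt n p x (s l)‖ ^ 2 : ℝ) : ℂ) ≠ 0 := by
      exact_mod_cast (sum_normSq_evalAt_pos hc.kodaira s x).ne'
    rw [mul_assoc, hev, (fubiniStudy_basisProduct _ x (hc.kodaira x)).2, ← htr', htr,
      Complex.ofReal_div, Complex.ofReal_inv, inv_div, div_eq_mul_inv, ← mul_assoc]
    ring
  rw [momentMap, hm]
  simp only [Matrix.sub_apply, Matrix.of_apply, Matrix.smul_apply, hFS, smul_eq_mul]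
  rw [h.integral_anticanVolume_mul _ hfc hf0, Complex.ofReal_div, h.totalVolume_mul _ hfc hf0,
    div_mul_eq_mul_div, mul_div_assoc, ← integral_mul_const, ← integral_sub, ← integral_const_mul]
  · refine integral_congr_ae (ae_of_all _ fun x => ?_)
    have hr' : ((Q x).trace.re : ℂ) ≠ 0 := by exact_mod_cast (hr x).ne'
    simp only [tracelessEntry_apply]
    rw [hpow x]
    have e := htr' x
    generalize (Q x).trace.re = r at e hr' ⊢
    rw [e]
    simp only [Complex.ofReal_mul, Complex.ofReal_natCast]
    generalize ((r ^ (q - 1) : ℝ) : ℂ) = a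
    linear_combination (c * a * Q x j k) * mul_inv_cancel₀ hr'
  · refine h.integrable_of_continuous ((Complex.continuous_ofReal.comp hfc).mul
      (.mul (.inv₀ ?_ ?_) (hQ.matrix_elem j k)))
    · exact Complex.continuous_ofReal.comp hrc
    · exact fun x => by exact_mod_cast (hr x).ne'
  · exact h.integrable_of_continuous ((Complex.continuous_ofReal.comp hfc).mul continuous_const)

theorem momentMap_expCurve (hc : IsConstantBergman h s κ) (hp : 0 < p) (hA : A.IsHermitian)
    (t : ℝ) (j k : Fin (dimSections n X p)) :
    momentMap (expCurve A s t) j k = ((κ ^ (-(1 / p : ℝ)) : ℝ) : ℂ) *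
      ∫ x, (((NormedSpace.exp (t • A) * coherentMatrix s x * NormedSpace.exp (t • A)).trace.re ^
        (-(1 / p : ℝ) - 1) : ℝ) : ℂ) * tracelessEntry j k
          (NormedSpace.exp (t • A) * coherentMatrix s x * NormedSpace.exp (t • A))
        ∂(anticanVolume n h.normSq) :=
  hc.momentMap_eq_integral (Real.rpow_pos_of_pos hc.pos _) _ _
    ((continuous_exp_mul_mul_exp A hc.continuous_coherentMatrix).comp (.prodMk_right t))
    (hc.trace_exp_pos hA t) (trace_exp_coherentMatrix hc.kodaira s hA t)
    (evalAt_expCurve_mul_conj hc.kodaira s hA t) (hc.basisMetric_expCurve hp hA t) j k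

end IsConstantBergman

end MomentMap

/-! ### The derivative at constant Bergman kernel, and its pairing with `A`. -/

theorem _root_.Matrix.IsHermitian.trace_mul_eq_re {ι : Type*} [Fintype ι] {A M : Matrix ι ι ℂ}
    (hA : A.IsHermitian) (hM : M.IsHermitian) : (A * M).trace = ((A * M).trace.re : ℂ) := by
  refine (Complex.conj_eq_iff_re.1 ?_).symm
  change star (A * M).trace = _
  rw [← Matrix.trace_conjTranspose, Matrix.conjTranspose_mul, hA.eq, hM.eq, Matrix.trace_mul_comm]

namespace IsConstantBergman

variable {n : ℕ} {X : Type*} [TopologicalSpace X] [ChartedSpace (Fin n → ℂ) X]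
  [IsManifold 𝓘(ℂ, Fin n → ℂ) ω X] {p : ℕ} [T2Space X] [CompactSpace X] [MeasurableSpace X]
  [BorelSpace X] {h : HermitianMetric n X}
  {s : Basis (Fin (dimSections n X p)) ℂ (HolSections n X p)} {κ : ℝ}
  {A : Matrix (Fin (dimSections n X p)) (Fin (dimSections n X p)) ℂ}

theorem totalVolume_basisMetric (hc : IsConstantBergman h s κ) (hp : 0 < p) :
    totalVolume n (basisMetric s) = κ ^ (-(1 / p : ℝ)) * totalVolume n h.normSq := by
  have h0 : basisMetric s = fun x => κ ^ (-(1 / p : ℝ)) * h.normSq x := by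
    -- The basis `s` itself is the curve for the zero matrix, on which `Tr Q = Tr M = 1`.
    have hs0 : expCurve (0 : Matrix _ _ ℂ) s 0 = s := by
      refine Basis.eq_of_apply_eq fun j => ?_
      rw [expCurve, glAct_apply]
      simp [Matrix.one_apply]
    have := hc.basisMetric_expCurve hp Matrix.isHermitian_zero 0
    rw [hs0] at this
    simpa [trace_coherentMatrix hc.kodaira s] using this
  apply Complex.ofReal_injective
  rw [h0, h.totalVolume_mul _ continuous_const fun _ => Real.rpow_nonneg hc.pos.le _]
  simp [totalVolume, mul_comm]

theorem hasDerivAt_momentMap_expCurve (hc : IsConstantBergman h s κ) (hp : 0 < p)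
    (hA : A.IsHermitian) (j k : Fin (dimSections n X p)) :
    HasDerivAt (fun t : ℝ => momentMap (expCurve A s t) j k)
      (((κ ^ (-(1 / p : ℝ)) : ℝ) : ℂ) *
        ∫ x, -2 * (1 + 1 / (p : ℂ)) * (A * coherentMatrix s x).trace *
            tracelessEntry j k (coherentMatrix s x) +
          tracelessEntry j k (A * coherentMatrix s x + coherentMatrix s x * A)
        ∂(anticanVolume n h.normSq)) 0 := by
  have := h.isFiniteMeasure_anticanVolume
  have hQ := continuous_exp_mul_mul_exp A hc.continuous_coherentMatrix
  have key := hasDerivAt_integral_rpow_trace_mul (anticanVolume n h.normSq)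
    (fun t x => NormedSpace.exp (t • A) * coherentMatrix s x * NormedSpace.exp (t • A))
    (fun t x => A * (NormedSpace.exp (t • A) * coherentMatrix s x * NormedSpace.exp (t • A)) +
      NormedSpace.exp (t • A) * coherentMatrix s x * NormedSpace.exp (t • A) * A)
    hQ ((continuous_const.mul hQ).add (hQ.mul continuous_const))
    (fun t x => hasDerivAt_exp_mul_mul_exp A (coherentMatrix s x) t)
    (hc.trace_exp_pos hA) (-(1 / p : ℝ) - 1) (tracelessEntry j k)
  simp_rw [hc.momentMap_expCurve hp hA]
  refine (key.const_mul _).congr_deriv ?_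
  congr 1
  refine integral_congr_ae (ae_of_all _ fun x => ?_)
  -- The power was taken of the real part of `Tr Q`, so its derivative involves the real part of
  -- `Tr(AM)`; this trace is real, both matrices being Hermitian.
  have hre := hA.trace_mul_eq_re (isHermitian_coherentMatrix s x)
  simp only [zero_smul, NormedSpace.exp_zero, one_mul, mul_one, trace_coherentMatrix hc.kodaira s,
    Complex.one_re, Real.one_rpow, Complex.ofReal_one, Matrix.trace_add,
    Matrix.trace_mul_comm (coherentMatrix s x) A]
  rw [hre]
  push_cast
  simp only [Complex.add_re, Complex.ofReal_re, Complex.ofReal_add]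
  ring

/-- The Rawnsley function is the constant `κ` and the Berezin symbol of `A` is `Tr(AM)`, so the
channel sends `A` to `κ ∫ Tr(AM) M dν_h`. -/
theorem trace_mul_quantumChannelMatrix (hc : IsConstantBergman h s κ)
    (T : Matrix (Fin (dimSections n X p)) (Fin (dimSections n X p)) ℂ) :
    (T * quantumChannelMatrix s h.normSq A).trace =
      κ * ∫ x, (A * coherentMatrix s x).trace * (T * coherentMatrix s x).trace
        ∂(anticanVolume n h.normSq) := by
  have hρ : ∀ x, rawnsley (n := n) p h.normSq x = κ := fun x => by
    rw [h.rawnsley_eq hc.kodaira s hc.orthonormal, hc.bergman, inv_mul_cancel_right₀]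
    exact (sum_normSq_evalAt_pos hc.kodaira s x).ne'
  have hE : ∀ j k, quantumChannelMatrix s h.normSq A j k =
      ∫ x, κ * (A * coherentMatrix s x).trace * coherentMatrix s x j k
        ∂(anticanVolume n h.normSq) := by
    intro j k
    have h1 : quantumChannelMatrix s h.normSq A =
        (LinearMap.toMatrix s s (quantumChannel s h.normSq (endOfMatrix s A))).transpose := rfl
    rw [h1, quantumChannel, toeplitz, endIntegral, LinearMap.toMatrix_toLin,
      Matrix.transpose_apply, Matrix.of_apply, h.l2Product_eq_basisProduct s hc.orthonormal]
    refine integral_congr_ae (ae_of_all _ fun x => ?_)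
    simp only
    rw [berezinSymbol_endOfMatrix, hρ, map_smul, coherentProjector_eq_endOfMatrix,
      endOfMatrix_eq, LinearMap.toMatrix_toLin, Matrix.smul_apply, Matrix.transpose_apply,
      smul_eq_mul, mul_comm (κ : ℂ)]
  have hM := hc.continuous_coherentMatrix
  have hi : ∀ j k, Integrable (fun x => T j k *
      (κ * (A * coherentMatrix s x).trace * coherentMatrix s x k j)) (anticanVolume n h.normSq) :=
    fun j k => h.integrable_of_continuous (continuous_const.mul
      ((continuous_const.mul (continuous_const.mul hM).matrix_trace).mul (hM.matrix_elem k j)))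
  have hT : ∀ E : Matrix (Fin (dimSections n X p)) (Fin (dimSections n X p)) ℂ,
      (T * E).trace = ∑ j, ∑ k, T j k * E k j := fun E => by
    simp only [Matrix.trace, Matrix.diag_apply, Matrix.mul_apply]
  have hI : ∫ x, κ * ((A * coherentMatrix s x).trace * (T * coherentMatrix s x).trace)
      ∂(anticanVolume n h.normSq) = ∫ x, ∑ j, ∑ k, T j k *
        (κ * (A * coherentMatrix s x).trace * coherentMatrix s x k j)
      ∂(anticanVolume n h.normSq) := by
    refine integral_congr_ae (ae_of_all _ fun x => ?_)
    simp only [hT, Finset.mul_sum]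
    refine Finset.sum_congr rfl fun j _ => Finset.sum_congr rfl fun k _ => ?_
    ring
  rw [← integral_const_mul, hI, hT,
    integral_finsetSum _ fun j _ => integrable_finsetSum _ fun k _ => hi j k]
  refine Finset.sum_congr rfl fun j _ => ?_
  rw [integral_finsetSum _ fun k _ => hi j k]
  refine Finset.sum_congr rfl fun k _ => ?_
  rw [hE, integral_const_mul]

/-- The derivative of the moment map at a basis with constant Bergman kernel. -/
theorem exists_hasDerivAt_momentMap (hc : IsConstantBergman h s κ) (hp : 0 < p)
    (hA : A.IsHermitian) (htr : A.trace = 0) :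
    ∃ D : Matrix (Fin (dimSections n X p)) (Fin (dimSections n X p)) ℂ,
      HasDerivAt (fun t : ℝ => momentMap (expCurve A s t)) D 0 ∧
      κ * (A * D).trace = ((κ ^ (-(1 / p : ℝ)) : ℝ) : ℂ) * (2 * ((A * A).trace -
        (1 + 1 / (p : ℂ)) * (A * quantumChannelMatrix s h.normSq A).trace)) := by
  refine ⟨Matrix.of fun j k => ((κ ^ (-(1 / p : ℝ)) : ℝ) : ℂ) *
    ∫ x, -2 * (1 + 1 / (p : ℂ)) * (A * coherentMatrix s x).trace *
        tracelessEntry j k (coherentMatrix s x) +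
      tracelessEntry j k (A * coherentMatrix s x + coherentMatrix s x * A)
    ∂(anticanVolume n h.normSq), hasDerivAt_pi.2 fun j => hasDerivAt_pi.2 fun k =>
    hc.hasDerivAt_momentMap_expCurve hp hA j k, ?_⟩
  have hκ : (κ : ℂ) ≠ 0 := by exact_mod_cast hc.pos.ne'
  have hM := hc.continuous_coherentMatrix
  have hAM : Continuous fun x => (A * coherentMatrix s x).trace :=
    (continuous_const.mul hM).matrix_trace
  have hφ : ∀ j k, Continuous (tracelessEntry (N := dimSections n X p) j k) := fun j k =>
    LinearMap.continuous_of_finiteDimensional _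
  have hi : ∀ j k, Integrable (fun x => A j k * (-2 * (1 + 1 / (p : ℂ)) *
      (A * coherentMatrix s x).trace * tracelessEntry k j (coherentMatrix s x) +
      tracelessEntry k j (A * coherentMatrix s x + coherentMatrix s x * A)))
      (anticanVolume n h.normSq) := fun j k =>
    h.integrable_of_continuous (continuous_const.mul (((continuous_const.mul hAM).mul
      ((hφ k j).comp hM)).add
        ((hφ k j).comp ((continuous_const.mul hM).add (hM.mul continuous_const)))))
  have hsum : ∀ x, ∑ j, ∑ k, A j k * (-2 * (1 + 1 / (p : ℂ)) *
      (A * coherentMatrix s x).trace * tracelessEntry k j (coherentMatrix s x) +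
      tracelessEntry k j (A * coherentMatrix s x + coherentMatrix s x * A)) =
      -2 * (1 + 1 / (p : ℂ)) *
        ((A * coherentMatrix s x).trace * (A * coherentMatrix s x).trace) +
        2 * (A * A * coherentMatrix s x).trace := by
    intro x
    -- By linearity of `tracelessEntry`, both terms of the integrand are contracted with `A` at
    -- once.
    have h1 := sum_mul_tracelessEntry htr ((-2 * (1 + 1 / (p : ℂ)) *
      (A * coherentMatrix s x).trace) • coherentMatrix s x +
        (A * coherentMatrix s x + coherentMatrix s x * A))
    simp only [map_add, map_smul, smul_eq_mul] at h1 ⊢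
    rw [h1]
    simp only [Matrix.mul_add, Matrix.trace_add, Matrix.mul_smul, Matrix.trace_smul, smul_eq_mul,
      ← Matrix.mul_assoc, Matrix.trace_mul_comm (A * coherentMatrix s x) A]
    ring
  have hD : ∀ c : ℂ, (A * Matrix.of fun j k => c * ∫ x, -2 * (1 + 1 / (p : ℂ)) *
      (A * coherentMatrix s x).trace * tracelessEntry j k (coherentMatrix s x) +
      tracelessEntry j k (A * coherentMatrix s x + coherentMatrix s x * A)
        ∂(anticanVolume n h.normSq)).trace = c * ∫ x, -2 * (1 + 1 / (p : ℂ)) *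
        ((A * coherentMatrix s x).trace * (A * coherentMatrix s x).trace) +
        2 * (A * A * coherentMatrix s x).trace ∂(anticanVolume n h.normSq) := by
    intro c
    simp_rw [← hsum]
    rw [integral_finsetSum _ fun j _ => integrable_finsetSum _ fun k _ => hi j k,
      Matrix.trace, Finset.mul_sum]
    refine Finset.sum_congr rfl fun j _ => ?_
    rw [integral_finsetSum _ fun k _ => hi j k, Matrix.diag_apply, Matrix.mul_apply,
      Finset.mul_sum]
    refine Finset.sum_congr rfl fun k _ => ?_
    rw [integral_const_mul, Matrix.of_apply]
    ring
  have hi₁ : Integrable (fun x => -2 * (1 + 1 / (p : ℂ)) *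
      ((A * coherentMatrix s x).trace * (A * coherentMatrix s x).trace))
      (anticanVolume n h.normSq) :=
    h.integrable_of_continuous (continuous_const.mul (hAM.mul hAM))
  have hi₂ : Integrable (fun x => 2 * (A * A * coherentMatrix s x).trace)
      (anticanVolume n h.normSq) :=
    h.integrable_of_continuous (continuous_const.mul (continuous_const.mul hM).matrix_trace)
  rw [hD, hc.trace_mul_quantumChannelMatrix, integral_add hi₁ hi₂,
    integral_const_mul, integral_const_mul, hc.integral_trace_mul_coherentMatrix]
  -- The factor `κ` on the left cancels the `κ⁻¹` of `∫ M = κ⁻¹ Id` in the term `Tr(A²)`; in the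
  -- other term it is already the one of the channel.
  linear_combination (((κ ^ (-(1 / p : ℝ)) : ℝ) : ℂ) * 2 * (A * A).trace) * mul_inv_cancel₀ hκ

end IsConstantBergman

end AnticanBalanced

/-! ### The balanced case. -/

theorem proposition3p7 (n : ℕ) (X : Type*) [TopologicalSpace X] [T2Space X] [CompactSpace X]
    [ChartedSpace (Fin n → ℂ) X] [IsManifold 𝓘(ℂ, Fin n → ℂ) ω X]
    [MeasurableSpace X] [BorelSpace X]
    (p : ℕ) (hp : 0 < p) (hKod : KodairaMapWellDefined n X p)
    (h : HermitianMetric n X) (hpos : h.IsPositive) (hbal : h.IsBalanced p)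
    (s : Module.Basis (Fin (dimSections n X p)) ℂ (HolSections n X p))
    (hs : ∀ j k, l2Product p h.normSq (s j) (s k) = if j = k then 1 else 0)
    (A : Matrix (Fin (dimSections n X p)) (Fin (dimSections n X p)) ℂ)
    (hA : A.IsHermitian) (htr : A.trace = 0) :
    ∃ D : Matrix (Fin (dimSections n X p)) (Fin (dimSections n X p)) ℂ,
      HasDerivAt (fun t : ℝ => momentMap (expCurve A s t)) D 0 ∧
      ((dimSections n X p / (2 * totalVolume n (basisMetric s)) : ℝ) : ℂ) * (A * D).trace =
        (A * A).trace -
          (1 + 1 / (p : ℂ)) * (A * quantumChannelMatrix s h.normSq A).trace := by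
  -- Without sections all matrices are empty and both sides vanish. A basis section is needed below
  -- to see that the volume is positive.
  rcases Nat.eq_zero_or_pos (dimSections n X p) with hN | hN
  · have : IsEmpty (Fin (dimSections n X p)) := by rw [hN]; infer_instance
    exact ⟨0, hasDerivAt_pi.2 fun j => isEmptyElim j, by simp [Matrix.trace]⟩
  have := h.isFiniteMeasure_anticanVolume
  have hV : 0 < totalVolume n h.normSq := by
    refine ENNReal.toReal_pos (fun h0 => ?_) (measure_ne_top _ _)
    -- If the volume vanished, a section of norm one would have norm zero.
    have h1 := hs ⟨0, hN⟩ ⟨0, hN⟩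
    rw [l2Product, Measure.measure_univ_eq_zero.1 h0] at h1
    simp at h1
  have hNr : (0 : ℝ) < dimSections n X p := by exact_mod_cast hN
  have hc : IsConstantBergman h s (dimSections n X p / totalVolume n h.normSq) :=
    ⟨hKod, hs, div_pos hNr hV, hbal.normSq_pow_eq hKod s hs hV.ne' hN.ne'⟩
  obtain ⟨D, hD, hE⟩ := hc.exists_hasDerivAt_momentMap hp hA htr
  refine ⟨D, hD, ?_⟩
  rw [hc.totalVolume_basisMetric hp]
  set c : ℝ := (dimSections n X p / totalVolume n h.normSq : ℝ) ^ (-(1 / p : ℝ)) with hcdef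
  have hc0 : (c : ℂ) ≠ 0 := by exact_mod_cast (Real.rpow_pos_of_pos hc.pos _).ne'
  have hV' : (totalVolume n h.normSq : ℂ) ≠ 0 := by exact_mod_cast hV.ne'
  -- As `Vol(dν_s) = c Vol(dν_h)`, the prefactor is `κ / (2c)`, which cancels the `2c` in `hE`.
  rw [show (dimSections n X p / (2 * (c * totalVolume n h.normSq)) : ℝ) =
    (2 * c)⁻¹ * (dimSections n X p / totalVolume n h.normSq) by
      rw [div_eq_mul_inv, div_eq_mul_inv]; simp only [mul_inv]; ring, Complex.ofReal_mul,
    mul_assoc, hE, Complex.ofReal_inv, Complex.ofReal_mul, Complex.ofReal_ofNat]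
  field_simp
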